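/- **Sequences and trees.** Let $\kappa$ be an inaccessible cardinal (uncountable, regular, strong limit). For a set $X$ let ${}^{<\kappa}X$ be the set of sequences in $X$ of ordinal length $<\kappa$, ordered by end-extension $\subseteq$, and let ${}^{\mathrm{Succ}(<\kappa)}X$ be the set of those whose length is a successor ordinal; ${}^{\gamma}X$ is the set of sequences of length $\gamma$. A DST-tree $\mathcal T$ on $2\times\kappa$ of height $\kappa$ is a set of pairs $(u,s)$, with $u\in{}^{<\kappa}2$ and $s\in{}^{<\kappa}\kappa$ of the same length, which is closed under (simultaneous) initial segments and such that $\kappa$ is the least ordinal greater than all lengths of its nodes. Let $\mathrm{Succ}(\mathcal T)$ be the set of nodes of $\mathcal T$ of successor length. For sets $\mathcal S,\mathcal S'$ of such pairs, a *witness* of $\mathcal S\leq_{\max}\mathcal S'$ is an injective, monotone, length-preserving map $\varphi:{}^{<\kappa}\kappa\to{}^{<\kappa}\kappa$ such that $(u,s)\in\mathcal S$ implies $(u,\varphi(s))\in\mathcal S'$. **Auxiliary choices.** Let $\mathrm{Hes}$ be the Hessenberg pairing function (the position of $(\alpha,\beta)$ when pairs of ordinals are ordered by maximum and then lexicographically),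 $\theta(i,\gamma,\alpha)=1+2\cdot\mathrm{Hes}(\gamma,\alpha)+i$ for $i=0,1$, and $\mu(\gamma)=(\max\{\omega_1,|\gamma+1|,\sup_{\alpha<\gamma}\mu(\alpha)\})^+$. Fix * any map $\#:{}^{\mathrm{Succ}(<\kappa)}\kappa\to\kappa$ whose restriction to ${}^{\gamma+1}\kappa$ is a bijection onto $\kappa$ for every $\gamma<\kappa$; * any linear orders $L_\gamma$ ($\gamma<\kappa$) with domain $\kappa$, without greatest element, such that $L_\gamma$ does not embed into $L_{\gamma'}$ for $\gamma\neq\gamma'$; * any linear orders $L^*_u$ ($u\in{}^{\mathrm{Succ}(<\kappa)}2$), where $L^*_u$ has cardinality $\mu(\gamma)$ if $u$ has length $\gamma+1$, is not a well-order, and does not embed into $L^*_v$ if $v\neq u$ has the same length. **Labels.** $\mathbf L_\gamma$ has the domain $\kappa\cup\{(\alpha,\beta):\alpha<\kappa,\ \beta<\theta(0,\gamma,\alpha)\}$; on $\kappa$ its order is that of $L_\gamma$; $\alpha'\preceq(\alpha,\beta)$ iff $\alpha'\preceq\alpha$; $(\alpha,\beta)\preceq(\alpha,\beta')$ iff $\beta\leq\beta'$;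 no other relation holds. For a linear order $I$ and $k\in\omega$ let $I^{(k)}$ be $I$, followed by a copy of $\omega$ with the reverse order, followed by $k$ pairwise incomparable triples $x,x^+,x^-$ in which just $x\preceq x^+$ and $x\preceq x^-$ (and reflexivity) hold. Put $\mathbf L_s=\theta(1,\gamma,\#s)^{(3)}$ for $s\in{}^{\gamma+1}\kappa$ and $\mathbf L^*_u=(L^*_u)^{(2)}$ for $u\in{}^{\mathrm{Succ}(<\kappa)}2$. **The tree $G_{\mathcal T}$.** It is the partial order obtained from $({}^{\mathrm{Succ}(<\kappa)}\kappa,\subseteq)$ by attaching to every $s$, of length $\gamma+1$ say, a copy of $(\mathbb Z,\leq)$ (the stem of $s$) and, above the whole stem, pairwise incomparable disjoint copies of $\mathbf L_\gamma$, of $\mathbf L_s$, and of $\mathbf L^*_u$ for each $u$ with $(u,s)\in\mathcal T$; a sequence $s$ lies below all points attached to $t$ iff $s\subseteq t$, and no other relation holds. Write $G\sqsubseteq G'$ if there is an embedding of $G$ into $G'$, i.e. a (necessarily injective) map $i$ with $x\preceq y\iff i(x)\preceq i(y)$. **Theorem.** Let $\kappa$ be inaccessible and let $\mathcal T,\mathcal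 T'$ be DST-trees on $2\times\kappa$ of height $\kappa$. For all choices of $\#$, $L_\gamma$, $L^*_u$ as above: 1. $G_{\mathcal T}\sqsubseteq G_{\mathcal T'}$ if and only if there is a witness $\varphi$ of $\mathrm{Succ}(\mathcal T)\leq_{\max}\mathcal T'$ such that $\#s\leq\#\varphi(s)$ for all $s\in{}^{\mathrm{Succ}(<\kappa)}\kappa$. If moreover every node of $\mathcal T$ of limit length has a proper extension in $\mathcal T$, or $\mathcal T'$ contains every pair $(u,s)$ of sequences of the same limit length all of whose proper initial segments are in $\mathcal T'$, then $G_{\mathcal T}\sqsubseteq G_{\mathcal T'}$ if and only if there is a witness $\varphi$ of $\mathcal T\leq_{\max}\mathcal T'$ such that $\#s\leq\#\varphi(s)$ for all $s\in{}^{\mathrm{Succ}(<\kappa)}\kappa$. 2. $G_{\mathcal T}\cong G_{\mathcal T'}$ if and only if $\mathrm{Succ}(\mathcal T)=\mathrm{Succ}(\mathcal T')$. -/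

import Mathlib

open Cardinal Ordinal

universe u v

namespace LabelTree

/-! ### Sequences of length less than `κ` -/

/-- The cardinal `κ`, as the type of the ordinals below it. -/
abbrev Below (κ : Cardinal.{u}) : Type (u + 1) := Set.Iio κ.ord

/-- The set `^{<κ} X` of sequences of elements of `X` whose length is an ordinal below `κ`. -/
@[ext]
structure Seq (κ : Cardinal.{u}) (X : Type v) where
  length : Ordinal.{u}
  length_lt : length < κ.ord
  val : Set.Iio length → X

/-- `s ≤ t` means that `s` is an initial segment of `t`. -/
instance {κ : Cardinal.{u}} {X : Type v} : LE (Seq κ X) where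
  le s t := ∃ h : s.length ≤ t.length,
    ∀ (α : Ordinal.{u}) (hα : α < s.length), s.val ⟨α, hα⟩ = t.val ⟨α, lt_of_lt_of_le hα h⟩

/-- The set `^{Succ(<κ)} X` of sequences in `^{<κ} X` of successor length. -/
def SuccSeq (κ : Cardinal.{u}) (X : Type v) : Type (max (u + 1) v) :=
  {s : Seq κ X // ∃ γ : Ordinal.{u}, s.length = γ + 1}

/-- `γ̄(s)`: the ordinal `γ < κ` such that `s` has length `γ + 1`. -/
noncomputable def SuccSeq.predLength {κ : Cardinal.{u}} {X : Type v} (s : SuccSeq κ X) :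
    Below κ :=
  ⟨s.2.choose,
    ((lt_add_one s.2.choose).trans_le s.2.choose_spec.ge).trans s.1.length_lt⟩

theorem SuccSeq.length_eq {κ : Cardinal.{u}} {X : Type v} (s : SuccSeq κ X) :
    s.1.length = (s.predLength : Ordinal.{u}) + 1 :=
  s.2.choose_spec

/-! ### Descriptive set-theoretical trees on `2 × κ` and the relation `≤_max` -/

/-- A node `(u, s)` on `2 × κ`. A sequence of pairs is identified with the pair of its coordinate
sequences, so only the pairs with `length u = length s` are relevant. -/
abbrev Node (κ : Cardinal.{u}) : Type (u + 1) := Seq κ (Fin 2) × Seq κ (Below κ)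

/-- `T` is a DST-tree on `2 × κ` (with nodes of length less than `κ`): a set of sequences closed
under initial segments. -/
structure IsDSTTree {κ : Cardinal.{u}} (T : Set (Node κ)) : Prop where
  length_eq : ∀ p ∈ T, p.1.length = p.2.length
  closed : ∀ p ∈ T, ∀ q : Node κ, q.1.length = q.2.length → q.1 ≤ p.1 → q.2 ≤ p.2 → q ∈ T

/-- The height of `T`: the least ordinal greater than the lengths of all nodes. -/
noncomputable def height {κ : Cardinal.{u}} (T : Set (Node κ)) : Ordinal.{u} :=
  sInf {α | ∀ p ∈ T, p.2.length < α}

/-- The nodes of `T` of successor length. -/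
def succPart {κ : Cardinal.{u}} (T : Set (Node κ)) : Set (Node κ) :=
  {p ∈ T | ∃ γ : Ordinal.{u}, p.2.length = γ + 1}

/-- Every node of limit length all of whose proper initial segments are in `T` is in `T`. -/
def IsLimitClosed {κ : Cardinal.{u}} (T : Set (Node κ)) : Prop :=
  ∀ p : Node κ, p.1.length = p.2.length → Order.IsSuccLimit p.2.length →
    (∀ q : Node κ, q.1.length = q.2.length → q.2.length < p.2.length →
      q.1 ≤ p.1 → q.2 ≤ p.2 → q ∈ T) → p ∈ T

/-- No node of `T` of limit length is maximal in `T`. -/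
def HasNoTerminalLimitNode {κ : Cardinal.{u}} (T : Set (Node κ)) : Prop :=
  ∀ p ∈ T, Order.IsSuccLimit p.2.length →
    ∃ q ∈ T, p.2.length < q.2.length ∧ p.1 ≤ q.1 ∧ p.2 ≤ q.2

/-- Lipschitz maps: monotone and length preserving. -/
structure IsLipschitz {κ : Cardinal.{u}} {X : Type v} (φ : Seq κ X → Seq κ X) : Prop where
  monotone : ∀ s t, s ≤ t → φ s ≤ φ t
  length_eq : ∀ s, (φ s).length = s.length

/-- The restriction of a Lipschitz map to the sequences of successor length. -/
def IsLipschitz.onSucc {κ : Cardinal.{u}} {X : Type v} {φ : Seq κ X → Seq κ X}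
    (h : IsLipschitz φ) (s : SuccSeq κ X) : SuccSeq κ X :=
  ⟨φ s.1, s.2.imp fun _ hγ => (h.length_eq s.1).trans hγ⟩

/-- `φ` is a witness of `T ≤_max T'`. -/
structure IsMaxWitness {κ : Cardinal.{u}} (T T' : Set (Node κ))
    (φ : Seq κ (Below κ) → Seq κ (Below κ)) : Prop where
  lipschitz : IsLipschitz φ
  injective : Function.Injective φ
  map_mem : ∀ (w : Seq κ (Fin 2)) (s : Seq κ (Below κ)), (w, s) ∈ T → (w, φ s) ∈ T'

/-! ### The Hessenberg pairing function and the functions `θ` and `μ` -/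

/-- The order type of `m × m` under the maximum-then-lexicographic order. -/
noncomputable def sq (m : Ordinal.{u}) : Ordinal.{u} :=
  ⨆ i : Set.Iio m, (sq i.1 + (i.1 + i.1) + 1)
termination_by m
decreasing_by exact i.2

/-- The Hessenberg pairing function: the position of `(α, β)` in the enumeration of all pairs of
ordinals, ordered by the maximum and then lexicographically; the pairs of maximum `m` come after
the `sq m` pairs of smaller maximum, in the order `(0, m), (1, m), …, (m, 0), (m, 1), …, (m, m)`.
It is characterized by `hes_le_iff` and `hes_surjective`. -/
noncomputable def hes (α β : Ordinal.{u}) : Ordinal.{u} :=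
  if α < β then sq β + α else sq α + (α + β)

theorem sq_succ_le {i m : Ordinal.{u}} (h : i < m) : sq i + (i + i) + 1 ≤ sq m := by
  rw [sq.eq_1 m]
  exact le_ciSup (f := fun i : Set.Iio m => sq i.1 + (i.1 + i.1) + 1) bddAbove_of_small ⟨i, h⟩

theorem hes_bounds (α β : Ordinal.{u}) :
    sq (max α β) ≤ hes α β ∧ hes α β < sq (max α β) + (max α β + max α β) + 1 := by
  unfold hes
  split_ifs with h
  · rw [max_eq_right h.le, Order.lt_add_one_iff]
    exact ⟨le_self_add, by gcongr; exact h.le.trans le_self_add⟩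
  · rw [max_eq_left (not_lt.1 h), Order.lt_add_one_iff]
    exact ⟨le_self_add, by gcongr; exact not_lt.1 h⟩

theorem hes_lt_of_lt {α β α' β' : Ordinal.{u}}
    (h : max α β < max α' β' ∨ (max α β = max α' β' ∧ (α < α' ∨ (α = α' ∧ β < β')))) :
    hes α β < hes α' β' := by
  rcases h with h | ⟨hm, h⟩
  · exact (hes_bounds α β).2.trans_le ((sq_succ_le h).trans (hes_bounds α' β').1)
  · unfold hes
    rcases h with h | ⟨rfl, h⟩
    · split_ifs with h1 h2 h2
      · rw [max_eq_right h1.le, max_eq_right h2.le] at hm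
        subst hm; gcongr
      · rw [max_eq_right h1.le, max_eq_left (not_lt.1 h2)] at hm
        subst hm; gcongr; exact h1.trans_le le_self_add
      · rw [max_eq_left (not_lt.1 h1), max_eq_right h2.le] at hm
        subst hm
        exact absurd h h2.asymm
      · rw [max_eq_left (not_lt.1 h1), max_eq_left (not_lt.1 h2)] at hm
        exact absurd hm h.ne
    · split_ifs with h1 h2 h2
      · rw [max_eq_right h1.le, max_eq_right h2.le] at hm
        exact absurd hm h.ne
      · exact absurd (h1.trans h) h2
      · rw [max_eq_left (not_lt.1 h1), max_eq_right h2.le] at hm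
        exact absurd hm h2.ne
      · gcongr

/-- The defining property of the Hessenberg pairing function. -/
theorem hes_le_iff (α β α' β' : Ordinal.{u}) :
    hes α β ≤ hes α' β' ↔
      max α β < max α' β' ∨ (max α β = max α' β' ∧ (α < α' ∨ (α = α' ∧ β ≤ β'))) := by
  constructor
  · intro h
    by_contra hc
    refine absurd (hes_lt_of_lt (α := α') (β := β') (α' := α) (β' := β) ?_) (not_lt.2 h)
    push Not at hc
    obtain ⟨h1, h2⟩ := hc
    rcases h1.lt_or_eq with h3 | h3
    · exact Or.inl h3
    · obtain ⟨h4, h5⟩ := h2 h3.symm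
      refine Or.inr ⟨h3, ?_⟩
      rcases h4.lt_or_eq with h6 | h6
      · exact Or.inl h6
      · exact Or.inr ⟨h6, h5 h6.symm⟩
  · rintro (h | ⟨hm, h | ⟨rfl, h⟩⟩)
    · exact (hes_lt_of_lt (Or.inl h)).le
    · exact (hes_lt_of_lt (Or.inr ⟨hm, Or.inl h⟩)).le
    · rcases h.lt_or_eq with h | rfl
      · exact (hes_lt_of_lt (Or.inr ⟨hm, Or.inr ⟨rfl, h⟩⟩)).le
      · exact le_rfl

theorem hes_surjective (ξ : Ordinal.{u}) : ∃ α β : Ordinal.{u}, hes α β = ξ := by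
  have hbig : ∀ m : Ordinal.{u}, m ≤ sq m := by
    intro m
    induction m using WellFoundedLT.induction with
    | ind m ih =>
      by_contra hc
      have h1 := sq_succ_le (not_le.1 hc)
      have h2 := ih _ (not_le.1 hc)
      have h3 : sq (sq m) ≤ sq (sq m) + (sq m + sq m) := le_self_add
      exact absurd (h2.trans h3) (not_le.2 (lt_of_lt_of_le (lt_add_one _) h1))
  have hex : ∃ m : Ordinal.{u}, ξ < sq m + (m + m) + 1 :=
    ⟨ξ, ((hbig ξ).trans le_self_add).trans_lt (lt_add_one _)⟩
  obtain ⟨m, hm, hmin⟩ := WellFounded.has_min (wellFounded_lt (α := Ordinal.{u}))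
    {m | ξ < sq m + (m + m) + 1} hex
  have hle : sq m ≤ ξ := by
    rw [sq.eq_1 m]
    exact ciSup_le' fun i => not_lt.1 fun h => hmin i.1 h i.2
  obtain ⟨δ, rfl⟩ : ∃ δ, sq m + δ = ξ := ⟨ξ - sq m, Ordinal.add_sub_cancel_of_le hle⟩
  have hδ : δ ≤ m + m := by
    have h : sq m + δ < sq m + (m + m) + 1 := hm
    exact le_of_add_le_add_left (Order.lt_add_one_iff.1 h)
  by_cases h : δ < m
  · exact ⟨δ, m, by simp [hes, h]⟩
  · obtain ⟨β, rfl⟩ : ∃ β, m + β = δ := ⟨δ - m, Ordinal.add_sub_cancel_of_le (not_lt.1 h)⟩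
    have hβ : β ≤ m := le_of_add_le_add_left hδ
    exact ⟨m, β, by simp [hes, not_lt.2 hβ]⟩

/-- `θ(i, γ, α) = 1 + 2 · Hes(γ, α) + i`, for `i = 0, 1`. -/
noncomputable def theta (i : Fin 2) (γ α : Ordinal.{u}) : Ordinal.{u} :=
  1 + 2 * hes γ α + (i.val : Ordinal.{u})

/-- `μ(γ) = (max {ω₁, |γ + 1|, sup {μ(α) | α < γ}})⁺`. -/
noncomputable def mu (γ : Ordinal.{u}) : Cardinal.{u} :=
  Order.succ (max (max (Cardinal.aleph 1) (γ + 1).card) (⨆ α : Set.Iio γ, mu α.1))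
termination_by γ
decreasing_by exact α.2

/-! ### Labels -/

/-- The domain of the label `𝓛_γ` of type I: the ordinals `α < κ` and the pairs `(α, β)` with
`α < κ` and `β < θ(0, γ, α)`. -/
inductive LabelI (κ : Cardinal.{u}) (γ : Ordinal.{u}) : Type (u + 1)
  | base (α : Below κ) : LabelI κ γ
  | side (α : Below κ) (β : Set.Iio (theta 0 γ α)) : LabelI κ γ

/-- The order of the label `𝓛_γ` of type I, where `r` is the linear order `L_γ`. -/
inductive LabelI.Le {κ : Cardinal.{u}} {γ : Ordinal.{u}} (r : Below κ → Below κ → Prop) :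
    LabelI κ γ → LabelI κ γ → Prop
  | base_base (α α' : Below κ) : r α α' → Le r (base α) (base α')
  | base_side (α' α : Below κ) (β : Set.Iio (theta 0 γ α)) : r α' α → Le r (base α') (side α β)
  | side_side (α : Below κ) (β β' : Set.Iio (theta 0 γ α)) :
      β ≤ β' → Le r (side α β) (side α β')

/-- The disjoint union of an initial part `I`, of `ω* = {n* | n ∈ ω}`, and of `k` triples
`x, x⁺, x⁻`, written `fork x 0`, `fork x 1`, `fork x 2`. -/
inductive Capped (I : Type v) (k : ℕ) : Type v
  | init (a : I) : Capped I k
  | desc (n : ℕ) : Capped I k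
  | fork (x : Fin k) (j : Fin 3) : Capped I k

/-- The order of a label of type II or III: the initial part with its order `r`, then a copy of
`ω*` above it, then the `k` pairwise incomparable triples `x`, `x⁺`, `x⁻` with `x` below `x⁺` and
`x⁻` only. -/
inductive Capped.Le {I : Type v} {k : ℕ} (r : I → I → Prop) : Capped I k → Capped I k → Prop
  | init_init (a b : I) : r a b → Le r (init a) (init b)
  | init_desc (a : I) (n : ℕ) : Le r (init a) (desc n)
  | init_fork (a : I) (x : Fin k) (j : Fin 3) : Le r (init a) (fork x j)
  | desc_desc (n m : ℕ) : m ≤ n → Le r (desc n) (desc m)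
  | desc_fork (n : ℕ) (x : Fin k) (j : Fin 3) : Le r (desc n) (fork x j)
  | fork_refl (x : Fin k) (j : Fin 3) : Le r (fork x j) (fork x j)
  | fork_root (x : Fin k) (j : Fin 3) : Le r (fork x 0) (fork x j)

/-- The domain of the label `𝓛_s` of type II: its initial part is the ordinal `θ(1, γ, #s)`, where
`length s = γ + 1`, and there are three triples. -/
abbrev LabelII {κ : Cardinal.{u}} (sharp : SuccSeq κ (Below κ) → Below κ)
    (s : SuccSeq κ (Below κ)) : Type (u + 1) :=
  Capped (Set.Iio (theta 1 s.predLength (sharp s))) 3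

/-- The domain of the label `𝓛*_w` of type III: its initial part is the linear order `L*_w`, and
there are two triples. -/
abbrev LabelIII {κ : Cardinal.{u}} (Lstar : SuccSeq κ (Fin 2) → Type u)
    (w : SuccSeq κ (Fin 2)) : Type u :=
  Capped (Lstar w) 2

/-! ### The tree `G_T` -/

/-- The domain of `G_T`: the sequences of successor length; for each such `s` its stem, a copy of
`ℤ`, a copy of the label `𝓛_γ` of type I with `length s = γ + 1`, a copy of the label `𝓛_s` of
type II, and a copy of the label `𝓛*_w` of type III for each `w` with `(w, s) ∈ T`. -/
inductive GDom {κ : Cardinal.{u}} (Lstar : SuccSeq κ (Fin 2) → Type u)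
    (sharp : SuccSeq κ (Below κ) → Below κ) (T : Set (Node κ)) : Type (u + 1)
  | seq (s : SuccSeq κ (Below κ)) : GDom Lstar sharp T
  | stem (s : SuccSeq κ (Below κ)) (z : ℤ) : GDom Lstar sharp T
  | labelI (s : SuccSeq κ (Below κ)) (x : LabelI κ s.predLength) : GDom Lstar sharp T
  | labelII (s : SuccSeq κ (Below κ)) (x : LabelII sharp s) : GDom Lstar sharp T
  | labelIII (s : SuccSeq κ (Below κ)) (w : SuccSeq κ (Fin 2)) (h : (w.1, s.1) ∈ T)
      (x : LabelIII Lstar w) : GDom Lstar sharp T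

/-- The order of `G_T`: the order of each of its parts; a sequence `s` lies below everything
attached to a `t` that extends `s`, and the stem of `s` lies below the labels attached to `s`. -/
inductive GLe {κ : Cardinal.{u}} (L : Below κ → Below κ → Below κ → Prop)
    (Lstar : SuccSeq κ (Fin 2) → Type u) [∀ w, LinearOrder (Lstar w)]
    (sharp : SuccSeq κ (Below κ) → Below κ) (T : Set (Node κ)) :
    GDom Lstar sharp T → GDom Lstar sharp T → Prop
  | seq_seq (s t) : s.1 ≤ t.1 → GLe L Lstar sharp T (.seq s) (.seq t)
  | seq_stem (s t z) : s.1 ≤ t.1 → GLe L Lstar sharp T (.seq s) (.stem t z)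
  | seq_labelI (s t x) : s.1 ≤ t.1 → GLe L Lstar sharp T (.seq s) (.labelI t x)
  | seq_labelII (s t x) : s.1 ≤ t.1 → GLe L Lstar sharp T (.seq s) (.labelII t x)
  | seq_labelIII (s t w h x) : s.1 ≤ t.1 → GLe L Lstar sharp T (.seq s) (.labelIII t w h x)
  | stem_stem (s) (z z' : ℤ) : z ≤ z' → GLe L Lstar sharp T (.stem s z) (.stem s z')
  | stem_labelI (s z x) : GLe L Lstar sharp T (.stem s z) (.labelI s x)
  | stem_labelII (s z x) : GLe L Lstar sharp T (.stem s z) (.labelII s x)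
  | stem_labelIII (s z w h x) : GLe L Lstar sharp T (.stem s z) (.labelIII s w h x)
  | labelI_labelI (s x x') : LabelI.Le (L s.predLength) x x' →
      GLe L Lstar sharp T (.labelI s x) (.labelI s x')
  | labelII_labelII (s) (x x' : LabelII sharp s) : Capped.Le (· ≤ ·) x x' →
      GLe L Lstar sharp T (.labelII s x) (.labelII s x')
  | labelIII_labelIII (s w h) (x x' : LabelIII Lstar w) : Capped.Le (· ≤ ·) x x' →
      GLe L Lstar sharp T (.labelIII s w h x) (.labelIII s w h x')

end LabelTree

namespace LabelTree

/-! ### Cardinality of the labels -/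

/-! An embedding of `G_T` into `G_T'` is forced to respect the anatomy of the trees. The invariant
is `Branching`, the height of the binary trees with incomparable siblings found above a point;
embeddings cannot lower it. Sequences have every height and no other point reaches height 4, so
sequences go to sequences. A stem goes into a single stem: its descending half cannot run through
sequences, its branching excludes labels of type I, and the `κ` points above it exclude the smaller
labels of types II and III (`exists_stem_of_stem`). Since `ℤ` is unbounded above, the labels of `s`
then go to labels of one `t` (`exists_isLabelOf`).

Each label transports one piece of information from `s` to `t`. Type I carries `L_γ`, so the lengths
agree (`predLength_eq_of_isLabelOf`). Type II carries the ordinal `θ(1, γ, #s)`, so `#s ≤ #t`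
(`sharp_le_of_isLabelOf`). Type III carries `L*_w`, so `(w, s) ∈ T` gives `(w, t) ∈ T'`
(`mem_of_isLabelOf`). The number of triples keeps type II out of type III, ill-foundedness keeps
type III out of type II, and the copy of `ω*` makes initial parts go to initial parts
(`Capped.exists_init_embedding`). A comparison of lengths identifies `t` with the image of `s`
(`exists_map_of_embedding`).

Conversely, a witness acts on each piece separately (`GDom.map`). Nodes of limit length leave no
trace in `G_T`, whence the successor parts in the statement; `extendSucc` supplies the values at
limits and `IsMaxWitness.of_succPart` the membership there. For an isomorphism, neither the induced
map nor its inverse decreases `#`, which is injective on each length, so sequences are fixed and the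
type III labels determine the successor part. -/

/-- Regularity of `κ`, in the form needed for suprema indexed by `Set.Iio m`, which lives one
universe higher. -/
theorem lift_mk_Iio_lt_cof {κ : Cardinal.{u}} (hκ : κ.IsRegular) {m : Ordinal.{u}}
    (hm : m < κ.ord) :
    Cardinal.lift.{u} #(Set.Iio m) < (Ordinal.lift.{u + 1} κ.ord).cof := by
  rw [Cardinal.mk_Iio_ordinal, Cardinal.lift_lift, ← Ordinal.lift_cof, hκ.cof_ord]
  exact Cardinal.lift_lt.2 (Cardinal.lt_ord.1 hm)

theorem sq_lt {κ : Cardinal.{u}} (hκ : κ.IsInaccessible) {m : Ordinal.{u}} (hm : m < κ.ord) :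
    sq m < κ.ord := by
  induction m using WellFoundedLT.induction with
  | ind m ih =>
    have hadd := isPrincipal_add_ord hκ.isRegular.aleph0_le
    rw [sq.eq_1]
    refine Ordinal.lift_iSup_lt_of_lt_cof.{u, u + 1} ?_ fun i => ?_
    · exact lift_mk_Iio_lt_cof hκ.isRegular hm
    · have hi := i.2.trans hm
      exact (isSuccLimit_ord hκ.isRegular.aleph0_le).add_one_lt
        (hadd (ih _ i.2 hi) (hadd hi hi))

theorem hes_lt {κ : Cardinal.{u}} (hκ : κ.IsInaccessible) {α β : Ordinal.{u}} (hα : α < κ.ord)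
    (hβ : β < κ.ord) : hes α β < κ.ord := by
  have hadd := isPrincipal_add_ord hκ.isRegular.aleph0_le
  have hm := max_lt hα hβ
  exact (hes_bounds α β).2.trans ((isSuccLimit_ord hκ.isRegular.aleph0_le).add_one_lt
        (hadd (sq_lt hκ hm) (hadd hm hm)))

theorem theta_lt {κ : Cardinal.{u}} (hκ : κ.IsInaccessible) (i : Fin 2) {α β : Ordinal.{u}}
    (hα : α < κ.ord) (hβ : β < κ.ord) : theta i α β < κ.ord := by
  have hadd := isPrincipal_add_ord hκ.isRegular.aleph0_le
  have hmul := isPrincipal_mul_ord hκ.isRegular.aleph0_le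
  have hn (n : ℕ) : (n : Ordinal) < κ.ord := by
    rw [Cardinal.lt_ord]; simpa using hκ.nat_lt n
  exact hadd (hadd (mod_cast hn 1) (hmul (mod_cast hn 2) (hes_lt hκ hα hβ))) (hn _)

theorem theta_pos (i : Fin 2) (γ α : Ordinal.{u}) : 0 < theta i γ α :=
  lt_of_lt_of_le zero_lt_one (le_self_add.trans le_self_add)

theorem theta_le_theta_iff (i : Fin 2) (γ α α' : Ordinal.{u}) :
    theta i γ α ≤ theta i γ α' ↔ α ≤ α' := by
  have key : ∀ {a b : Ordinal.{u}}, a < b → theta i γ a < theta i γ b := by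
    intro a b h
    have hh : hes γ a < hes γ b := by
      refine hes_lt_of_lt ?_
      rcases (max_le_max_left γ h.le).lt_or_eq with h1 | h1
      · exact Or.inl h1
      · exact Or.inr ⟨h1, Or.inr ⟨rfl, h⟩⟩
    -- The factor 2 leaves room for the summand `i ≤ 1`.
    have h2 : 2 * hes γ a + 2 ≤ 2 * hes γ b := by
      rw [← mul_add_one]
      gcongr
      exact Order.add_one_le_iff.2 hh
    have h3 : ((i.val : ℕ) : Ordinal.{u}) < 2 := mod_cast i.2
    calc theta i γ a = 1 + 2 * hes γ a + (i.val : Ordinal.{u}) := rfl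
      _ < 1 + 2 * hes γ a + 2 := by gcongr
      _ ≤ 1 + 2 * hes γ b := by rw [add_assoc]; gcongr
      _ ≤ theta i γ b := le_self_add
  exact (show StrictMono (theta i γ) from fun _ _ => key).le_iff_le

/-- Regularity bounds the supremum, and `κ` is a limit cardinal. This makes every label of type III
smaller than `κ`. -/
theorem mu_lt {κ : Cardinal.{u}} (hκ : κ.IsInaccessible) {γ : Ordinal.{u}} (hγ : γ < κ.ord) :
    mu γ < κ := by
  induction γ using WellFoundedLT.induction with
  | ind γ ih =>
    have hlim := hκ.isStrongLimit.isSuccLimit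
    rw [mu.eq_1]
    refine hlim.succ_lt (max_lt (max_lt ?_ ?_) ?_)
    · have := hlim.succ_lt hκ.aleph0_lt
      rwa [Cardinal.succ_aleph0] at this
    · exact Cardinal.lt_ord.1 ((isSuccLimit_ord hκ.isRegular.aleph0_le).add_one_lt hγ)
    · refine Cardinal.lift_iSup_lt_of_lt_cof_ord.{u, u + 1} ?_ fun i => ih _ i.2 (i.2.trans hγ)
      rw [← Cardinal.lift_ord]
      exact lift_mk_Iio_lt_cof hκ.isRegular hγ

theorem mk_capped_lt {I : Type v} {k : ℕ} {c : Cardinal.{v}} (hc : ℵ₀ < c) (hI : #I < c) :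
    #(Capped I k) < c := by
  let e : Capped I k → I ⊕ ULift.{v} (ℕ ⊕ (Fin k × Fin 3)) := fun
    | .init a => .inl a
    | .desc n => .inr ⟨.inl n⟩
    | .fork x j => .inr ⟨.inr (x, j)⟩
  have he : Function.Injective e := by
    rintro (a | n | ⟨x, j⟩) (b | m | ⟨y, l⟩) h <;> simp_all [e]
  refine (mk_le_of_injective he).trans_lt ?_
  rw [mk_sum]
  refine add_lt_of_lt hc.le (by simpa using hI) ?_
  simp only [mk_uLift]
  refine lt_of_le_of_lt ?_ hc
  simp

theorem mk_below (κ : Cardinal.{u}) : #(Below κ) = Cardinal.lift.{u + 1} κ := by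
  rw [Cardinal.mk_Iio_ordinal, card_ord]

/-! ### Sequences -/

section Sequences

variable {κ : Cardinal.{u}} {X : Type v}

theorem Seq.le_refl (s : Seq κ X) : s ≤ s := ⟨_root_.le_refl _, fun _ _ => rfl⟩

theorem Seq.le_trans {s t r : Seq κ X} (h : s ≤ t) (h' : t ≤ r) : s ≤ r :=
  ⟨h.1.trans h'.1, fun α hα => (h.2 α hα).trans (h'.2 α (hα.trans_le h.1))⟩

theorem Seq.eq_of_le {s t : Seq κ X} (h : s ≤ t) (hl : t.length ≤ s.length) : s = t := by
  obtain ⟨a, ha, f⟩ := s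
  obtain ⟨b, hb, g⟩ := t
  obtain ⟨h1, h2⟩ := h
  obtain rfl : a = b := le_antisymm h1 hl
  congr
  funext x
  exact h2 x.1 x.2

theorem Seq.le_antisymm {s t : Seq κ X} (h : s ≤ t) (h' : t ≤ s) : s = t :=
  Seq.eq_of_le h h'.1

theorem Seq.le_of_le_of_le {s t r : Seq κ X} (hs : s ≤ r) (ht : t ≤ r)
    (hl : s.length ≤ t.length) : s ≤ t :=
  ⟨hl, fun α hα => (hs.2 α hα).trans (ht.2 α (hα.trans_le hl)).symm⟩

/-- The initial segment of `s` of length `α`, or `s` itself if `s` is shorter. -/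
noncomputable def Seq.take (s : Seq κ X) (α : Ordinal.{u}) : Seq κ X where
  length := min α s.length
  length_lt := (min_le_right _ _).trans_lt s.length_lt
  val β := s.val ⟨β.1, (Set.mem_Iio.1 β.2).trans_le (min_le_right _ _)⟩

theorem Seq.take_le (s : Seq κ X) (α : Ordinal.{u}) : s.take α ≤ s :=
  ⟨min_le_right _ _, fun _ _ => rfl⟩

theorem Seq.length_take {s : Seq κ X} {α : Ordinal.{u}} (h : α ≤ s.length) :
    (s.take α).length = α := min_eq_left h

theorem Seq.take_eq_of_le {s t : Seq κ X} (h : s ≤ t) {α : Ordinal.{u}} (hα : α ≤ s.length) :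
    s.take α = t.take α :=
  Seq.eq_of_le
    (Seq.le_of_le_of_le (Seq.le_trans (s.take_le α) h) (t.take_le α)
      (by rw [length_take hα, length_take (hα.trans h.1)]))
    (by rw [length_take hα, length_take (hα.trans h.1)])

/-- The sequence `s` followed by the entry `a`. -/
noncomputable def Seq.snoc (hκ : ℵ₀ ≤ κ) (s : Seq κ X) (a : X) : Seq κ X where
  length := s.length + 1
  length_lt := (isSuccLimit_ord hκ).add_one_lt s.length_lt
  val β := if h : β.1 < s.length then s.val ⟨β.1, h⟩ else a

theorem Seq.le_snoc (hκ : ℵ₀ ≤ κ) (s : Seq κ X) (a : X) : s ≤ s.snoc hκ a :=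
  ⟨(lt_add_one s.length).le, fun α hα => by simp [snoc, hα]⟩

theorem Seq.snoc_le_iff (hκ : ℵ₀ ≤ κ) (s : Seq κ X) (a b : X) :
    s.snoc hκ a ≤ s.snoc hκ b ↔ a = b := by
  constructor
  · intro h
    simpa [snoc] using h.2 s.length (lt_add_one s.length)
  · rintro rfl
    exact Seq.le_refl _

theorem SuccSeq.predLength_eq_iff {Y : Type*} (s : SuccSeq κ X) (t : SuccSeq κ Y) :
    s.predLength = t.predLength ↔ s.1.length = t.1.length := by
  rw [s.length_eq, t.length_eq, Subtype.ext_iff]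
  simp

/-- The initial segment of `s` of length `α + 1`. -/
noncomputable def Seq.takeSucc (s : Seq κ X) {α : Ordinal.{u}} (h : α < s.length) : SuccSeq κ X :=
  ⟨s.take (α + 1), α, Seq.length_take (Order.add_one_le_iff.2 h)⟩

theorem Seq.length_takeSucc (s : Seq κ X) {α : Ordinal.{u}} (h : α < s.length) :
    (s.takeSucc h).1.length = α + 1 := Seq.length_take (Order.add_one_le_iff.2 h)

theorem Seq.takeSucc_le (s : Seq κ X) {α : Ordinal.{u}} (h : α < s.length) :
    (s.takeSucc h).1 ≤ s := s.take_le _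

theorem Seq.takeSucc_eq_of_le {s t : Seq κ X} (h : s ≤ t) {α : Ordinal.{u}} (hα : α < s.length) :
    s.takeSucc hα = t.takeSucc (hα.trans_le h.1) :=
  Subtype.ext (take_eq_of_le h (Order.add_one_le_iff.2 hα))

/-- The entry at `α` is seen by the initial segment of length `α + 1`, so successor lengths suffice
even for limit `s`. -/
theorem Seq.le_of_takeSucc_le {s t : Seq κ X} (hl : s.length ≤ t.length)
    (h : ∀ α (hα : α < s.length), (s.takeSucc hα).1 ≤ t) : s ≤ t := by
  refine ⟨hl, fun α hα => ?_⟩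
  exact (h α hα).2 α (by rw [length_takeSucc]; exact lt_add_one α)

end Sequences

/-! ### Lipschitz maps determined by their values at successor lengths -/

section Extension

variable {κ : Cardinal.{u}} {X : Type v} {f : SuccSeq κ X → SuccSeq κ X}

/-- The Lipschitz map that extends a length preserving map on the sequences of successor length. -/
noncomputable def extendSucc (f : SuccSeq κ X → SuccSeq κ X)
    (hlen : ∀ s, (f s).1.length = s.1.length) (s : Seq κ X) : Seq κ X where
  length := s.length
  length_lt := s.length_lt
  val α := (f (s.takeSucc (Set.mem_Iio.1 α.2))).1.val
    ⟨α.1, ((lt_add_one α.1).trans_eq (s.length_takeSucc _).symm).trans_eq (hlen _).symm⟩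

theorem extendSucc_le {hlen : ∀ s, (f s).1.length = s.1.length} {s t : Seq κ X} (h : s ≤ t) :
    extendSucc f hlen s ≤ extendSucc f hlen t := by
  refine ⟨h.1, fun α hα => ?_⟩
  have key : ∀ (a b : SuccSeq κ X), a = b → ∀ ha hb,
      (f a).1.val ⟨α, ha⟩ = (f b).1.val ⟨α, hb⟩ := by
    rintro a _ rfl _ _
    rfl
  exact key _ _ (Seq.takeSucc_eq_of_le h hα) _ _

/-- The extension reads its entry at `α` off the last entry of `f` at the initial segment of length
`α + 1`; monotonicity makes this the entry of `f s` itself. -/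
theorem extendSucc_eq {hlen : ∀ s, (f s).1.length = s.1.length}
    (hf : ∀ s t, s.1 ≤ t.1 → (f s).1 ≤ (f t).1) (s : SuccSeq κ X) :
    extendSucc f hlen s.1 = (f s).1 := by
  refine Seq.eq_of_le ⟨(hlen s).ge, fun α hα => ?_⟩ (hlen s).le
  exact (hf _ s (s.1.takeSucc_le hα)).2 α _

theorem isLipschitz_extendSucc (hlen : ∀ s, (f s).1.length = s.1.length) :
    IsLipschitz (extendSucc f hlen) :=
  ⟨fun _ _ => extendSucc_le, fun _ => rfl⟩

theorem IsLipschitz.map_takeSucc {φ : Seq κ X → Seq κ X} (h : IsLipschitz φ) (s : Seq κ X)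
    {α : Ordinal.{u}} (hα : α < s.length) :
    φ (s.takeSucc hα).1 = ((φ s).takeSucc (hα.trans_eq (h.length_eq s).symm)).1 := by
  have e : (φ (s.takeSucc hα).1).length = α + 1 := by
    rw [h.length_eq, Seq.length_takeSucc]
  refine Seq.eq_of_le (Seq.le_of_le_of_le (h.monotone _ _ (s.takeSucc_le hα))
    (Seq.takeSucc_le _ _) ?_) ?_ <;> rw [e, Seq.length_takeSucc]

theorem IsLipschitz.injective {φ : Seq κ X → Seq κ X} (h : IsLipschitz φ)
    (hinj : ∀ s t : SuccSeq κ X, φ s.1 = φ t.1 → s = t) : Function.Injective φ := by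
  intro s t hst
  have hl : s.length = t.length := by rw [← h.length_eq s, hst, h.length_eq]
  refine Seq.eq_of_le (Seq.le_of_takeSucc_le hl.le fun α hα => ?_) hl.ge
  have hα' : α < t.length := hl ▸ hα
  have : s.takeSucc hα = t.takeSucc hα' := hinj _ _ (by
    rw [h.map_takeSucc, h.map_takeSucc]
    congr)
  rw [this]
  exact t.takeSucc_le hα'

/-- If `φ s ≤ φ t`, then `φ s` and the image of the initial segment of `t` of length `s.length` are
initial segments of `φ t` of the same length, so injectivity applies. -/
theorem IsLipschitz.le_iff {φ : Seq κ X → Seq κ X} (h : IsLipschitz φ)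
    (hinj : Function.Injective φ) (s t : Seq κ X) : φ s ≤ φ t ↔ s ≤ t := by
  refine ⟨fun hle => ?_, h.monotone s t⟩
  have hl : s.length ≤ t.length := by simpa [h.length_eq] using hle.1
  have : φ s = φ (t.take s.length) := by
    have e := (h.length_eq (t.take s.length)).trans (Seq.length_take hl)
    refine Seq.eq_of_le (Seq.le_of_le_of_le hle (h.monotone _ _ (t.take_le _)) ?_) ?_ <;>
      rw [e, h.length_eq]
  rw [hinj this]
  exact t.take_le _

end Extension

/-! ### Witnesses on all nodes and on the nodes of successor length -/

section Witness

variable {κ : Cardinal.{u}} {T T' : Set (Node κ)} {φ : Seq κ (Below κ) → Seq κ (Below κ)}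

/-- A node with a proper extension in `T` has one that is longer by exactly one; its image is in
`T'`, which is closed under initial segments. This leaves only terminal nodes of limit length, which
the limit closure of `T'` handles. -/
theorem IsMaxWitness.of_succPart (hκ : ℵ₀ ≤ κ) (hT : IsDSTTree T) (hT' : IsDSTTree T')
    (hT_height : height T = κ.ord)
    (h : IsMaxWitness (succPart T) T' φ)
    (hlim : HasNoTerminalLimitNode T ∨ IsLimitClosed T') : IsMaxWitness T T' φ := by
  refine ⟨h.lipschitz, h.injective, fun w s hws => ?_⟩
  have hlen : w.length = s.length := hT.length_eq _ hws
  have key : ∀ q ∈ T, s.length < q.2.length → w ≤ q.1 → s ≤ q.2 → (w, φ s) ∈ T' := by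
    intro q hq hl h1 h2
    have hql := hT.length_eq _ hq
    have hl' : s.length < q.1.length := hl.trans_eq hql.symm
    have hmem : ((q.1.takeSucc hl').1, (q.2.takeSucc hl).1) ∈ succPart T :=
      ⟨hT.closed _ hq _ (by simp [Seq.length_takeSucc]) (Seq.takeSucc_le _ hl')
        (Seq.takeSucc_le _ hl), s.length, Seq.length_takeSucc _ hl⟩
    refine hT'.closed _ (h.map_mem _ _ hmem) _ ?_ ?_ ?_
    · simp [h.lipschitz.length_eq, hlen]
    · refine Seq.le_of_le_of_le h1 (Seq.takeSucc_le _ hl') ?_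
      simp [Seq.length_takeSucc, hlen]
    · refine h.lipschitz.monotone _ _ (Seq.le_of_le_of_le h2 (Seq.takeSucc_le _ hl) ?_)
      simp [Seq.length_takeSucc]
  rcases Ordinal.zero_or_succ_or_isSuccLimit s.length with h0 | ⟨γ, hγ⟩ | hs
  -- This is where the height is used: a tree with only the empty node has height at most 1.
  · obtain ⟨q, hq, hq0⟩ : ∃ q ∈ T, 0 < q.2.length := by
      by_contra! hc
      have : height T ≤ 1 := csInf_le' fun p hp => (hc p hp).trans_lt zero_lt_one
      rw [hT_height] at this
      exact (this.trans_lt (Ordinal.one_lt_omega0.trans_le (Cardinal.omega0_le_ord.2 hκ))).false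
    refine key q hq (h0 ▸ hq0) ⟨?_, fun α hα => ?_⟩ ⟨?_, fun α hα => ?_⟩
    · simp [hlen, h0]
    · simp [hlen, h0] at hα
    · simp [h0]
    · simp [h0] at hα
  · exact h.map_mem _ _ ⟨hws, γ, hγ.symm⟩
  · rcases hlim with hT1 | hT1
    · obtain ⟨q, hq, h1, h2, h3⟩ := hT1 _ hws hs
      exact key q hq h1 h2 h3
    · refine hT1 _ (by simp [h.lipschitz.length_eq, hlen])
        (by simpa [h.lipschitz.length_eq] using hs) fun q hq1 hq2 hq3 hq4 => ?_
      simp only [h.lipschitz.length_eq] at hq2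
      have hq2w := hq2.trans_eq hlen.symm
      have hmem : ((w.takeSucc hq2w).1, (s.takeSucc hq2).1) ∈ succPart T :=
        ⟨hT.closed _ hws _ (by simp [Seq.length_takeSucc]) (Seq.takeSucc_le _ hq2w)
          (Seq.takeSucc_le _ hq2), _, Seq.length_takeSucc _ hq2⟩
      refine hT'.closed _ (h.map_mem _ _ hmem) q hq1 ?_ ?_
      · exact Seq.le_of_le_of_le hq3 (Seq.takeSucc_le _ hq2w)
          (by simp [Seq.length_takeSucc, hq1])
      · exact Seq.le_of_le_of_le hq4 (h.lipschitz.monotone _ _ (Seq.takeSucc_le _ hq2))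
          (by simp [h.lipschitz.length_eq, Seq.length_takeSucc])

theorem IsMaxWitness.succPart (h : IsMaxWitness T T' φ) :
    IsMaxWitness (LabelTree.succPart T) T' φ :=
  ⟨h.lipschitz, h.injective, fun w s hws => h.map_mem w s hws.1⟩

end Witness

/-! ### Iterated branching -/

section Branching

variable {A : Type*} {B : Type*} {r : A → A → Prop} {r' : B → B → Prop}

/-- Above `x` there is a binary tree of height `n` whose immediate successors are incomparable. -/
def Branching (r : A → A → Prop) : ℕ → A → Prop
  | 0, _ => True
  | n + 1, x => ∃ y z, r x y ∧ r x z ∧ ¬ r y z ∧ ¬ r z y ∧ Branching r n y ∧ Branching r n z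

theorem Branching.map (e : r ↪r r') {n : ℕ} {x : A} (h : Branching r n x) :
    Branching r' n (e x) := by
  induction n generalizing x with
  | zero => trivial
  | succ n ih =>
    obtain ⟨y, z, h1, h2, h3, h4, h5, h6⟩ := h
    exact ⟨e y, e z, e.map_rel_iff.2 h1, e.map_rel_iff.2 h2, mt e.map_rel_iff.1 h3,
      mt e.map_rel_iff.1 h4, ih h5, ih h6⟩

/-- Branching is reflected only because the image is closed upwards. Labels sit in `G_T` in this
way, so their branching can be computed inside the label. -/
theorem Branching.of_map (e : r ↪r r') (he : ∀ x y, r' (e x) y → ∃ x', y = e x') {n : ℕ} {x : A}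
    (h : Branching r' n (e x)) : Branching r n x := by
  induction n generalizing x with
  | zero => trivial
  | succ n ih =>
    obtain ⟨y, z, h1, h2, h3, h4, h5, h6⟩ := h
    obtain ⟨y, rfl⟩ := he _ _ h1
    obtain ⟨z, rfl⟩ := he _ _ h2
    exact ⟨y, z, e.map_rel_iff.1 h1, e.map_rel_iff.1 h2, mt e.map_rel_iff.2 h3,
      mt e.map_rel_iff.2 h4, ih h5, ih h6⟩

theorem Branching.of_succ {n : ℕ} {x : A} (h : Branching r (n + 1) x) : Branching r n x := by
  induction n generalizing x with
  | zero => trivial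
  | succ n ih =>
    obtain ⟨y, z, h1, h2, h3, h4, h5, h6⟩ := h
    exact ⟨y, z, h1, h2, h3, h4, ih h5, ih h6⟩

end Branching

/-! ### Labels of type I -/

section LabelI

variable {κ : Cardinal.{u}} {γ : Ordinal.{u}} {r : Below κ → Below κ → Prop}

theorem LabelI.le_base_base_iff {α α' : Below κ} :
    LabelI.Le (γ := γ) r (.base α) (.base α') ↔ r α α' :=
  ⟨fun h => by cases h; assumption, .base_base α α'⟩

theorem LabelI.not_branching_one_side [IsLinearOrder (Below κ) r] (α : Below κ)
    (β : Set.Iio (theta 0 γ α)) : ¬ Branching (LabelI.Le r) 1 (.side α β) := by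
  rintro ⟨y, z, hy, hz, hyz, hzy, -, -⟩
  cases hy with
  | side_side _ _ b _ =>
    cases hz with
    | side_side _ _ b' _ =>
      rcases le_total b b' with h | h
      · exact hyz (.side_side _ _ _ h)
      · exact hzy (.side_side _ _ _ h)

theorem LabelI.exists_eq_base [IsLinearOrder (Below κ) r] {x : LabelI κ γ}
    (h : Branching (LabelI.Le r) 1 x) : ∃ α, x = .base α := by
  cases x with
  | base α => exact ⟨α, rfl⟩
  | side α β => exact absurd h (not_branching_one_side α β)

/-- Only base points have two incomparable points above them, and base points are linearly ordered.
-/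
theorem LabelI.not_branching_two [IsLinearOrder (Below κ) r] (x : LabelI κ γ) :
    ¬ Branching (LabelI.Le r) 2 x := by
  rintro ⟨y, z, -, -, hyz, hzy, hy, hz⟩
  obtain ⟨a, rfl⟩ := exists_eq_base hy
  obtain ⟨b, rfl⟩ := exists_eq_base hz
  rcases total_of r a b with h | h
  · exact hyz (.base_base _ _ h)
  · exact hzy (.base_base _ _ h)

/-- A strictly larger base point is incomparable with the side points over `α`; this is why `L_γ`
must have no greatest element. -/
theorem LabelI.branching_one_base [IsLinearOrder (Below κ) r] (hr : ∀ a, ∃ b, r a b ∧ b ≠ a)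
    (α : Below κ) : Branching (LabelI.Le (γ := γ) r) 1 (.base α) := by
  obtain ⟨β, hab, hne⟩ := hr α
  refine ⟨.base β, .side α ⟨0, theta_pos _ _ _⟩, .base_base _ _ hab,
    .base_side _ _ _ (refl_of r α), ?_, ?_, trivial, trivial⟩
  · intro h
    cases h with
    | base_side _ _ _ h => exact hne (antisymm_of r h hab)
  · intro h
    cases h

end LabelI

/-! ### Labels of types II and III -/

section Capped

variable {I J : Type*} [LinearOrder I] [LinearOrder J] {k l : ℕ}

/-- The order of a label of type II or III with initial part `I`. -/
abbrev cappedLE (I : Type*) [LinearOrder I] (k : ℕ) : Capped I k → Capped I k → Prop :=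
  Capped.Le (· ≤ ·)

theorem Capped.le_desc_iff {n m : ℕ} : cappedLE I k (.desc n) (.desc m) ↔ m ≤ n :=
  ⟨fun h => by cases h; assumption, .desc_desc n m⟩

theorem Capped.le_init_iff {a b : I} : cappedLE I k (.init a) (.init b) ↔ a ≤ b :=
  ⟨fun h => by cases h; assumption, .init_init a b⟩

theorem Capped.le_or_le_desc (x : Capped I k) (n : ℕ) :
    cappedLE I k x (.desc n) ∨ cappedLE I k (.desc n) x := by
  cases x with
  | init a => exact Or.inl (.init_desc _ _)
  | desc m => exact (le_total n m).imp (.desc_desc _ _) (.desc_desc _ _)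
  | fork x j => exact Or.inr (.desc_fork _ _ _)

theorem Capped.le_or_le_init (x : Capped I k) (a : I) :
    cappedLE I k x (.init a) ∨ cappedLE I k (.init a) x := by
  cases x with
  | init b => exact (le_total b a).imp (.init_init _ _) (.init_init _ _)
  | desc m => exact Or.inr (.init_desc _ _)
  | fork x j => exact Or.inr (.init_fork _ _ _)

theorem Capped.eq_zero_of_branching_one {x : Fin k} {j : Fin 3}
    (h : Branching (cappedLE I k) 1 (.fork x j)) : j = 0 := by
  obtain ⟨y, z, hy, hz, hyz, -, -, -⟩ := h
  cases hy with
  | fork_root => rfl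
  | fork_refl =>
    cases hz with
    | fork_root => rfl
    | fork_refl => exact absurd (.fork_refl _ _) hyz

theorem Capped.branching_one_fork (x : Fin k) : Branching (cappedLE I k) 1 (.fork x 0) := by
  refine ⟨.fork x 1, .fork x 2, .fork_root _ _, .fork_root _ _, ?_, ?_, trivial, trivial⟩ <;>
  · intro h
    cases h

theorem Capped.not_branching_two_fork (x : Fin k) (j : Fin 3) :
    ¬ Branching (cappedLE I k) 2 (.fork x j) := by
  rintro ⟨y, z, hy, hz, hyz, -, hy1, hz1⟩
  have key : ∀ y, cappedLE I k (.fork x j) y → Branching (cappedLE I k) 1 y → y = .fork x 0 := by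
    intro y h h1
    cases h <;> rw [eq_zero_of_branching_one h1]
  rw [key y hy hy1, key z hz hz1] at hyz
  exact hyz (.fork_refl _ _)

/-- Points of the initial part and of `ω*` are comparable with everything, and points of the triples
do not reach height 2. -/
theorem Capped.not_branching_three (x : Capped I k) : ¬ Branching (cappedLE I k) 3 x := by
  rintro ⟨y, z, -, -, hyz, hzy, hy, -⟩
  have : cappedLE I k z y ∨ cappedLE I k y z := by
    cases y with
    | init a => exact z.le_or_le_init a
    | desc n => exact z.le_or_le_desc n
    | fork x j => exact absurd hy (not_branching_two_fork x j)
  exact this.elim hzy hyz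

theorem Capped.not_fork_le {x y : Fin k} (h : x ≠ y) (j j' : Fin 3) :
    ¬ cappedLE I k (.fork x j) (.fork y j') := by
  intro hle
  cases hle <;> exact h rfl

theorem Capped.branching_two_of_le {x : Capped I k} (hk : 2 ≤ k)
    (h : ∀ (y : Fin k) (j : Fin 3), cappedLE I k x (.fork y j)) : Branching (cappedLE I k) 2 x := by
  have hne : (⟨0, by omega⟩ : Fin k) ≠ ⟨1, by omega⟩ := by simp
  exact ⟨_, _, h ⟨0, by omega⟩ 0, h ⟨1, by omega⟩ 0, not_fork_le hne _ _, not_fork_le hne.symm _ _,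
    branching_one_fork _, branching_one_fork _⟩

theorem Capped.branching_two_init (hk : 2 ≤ k) (a : I) : Branching (cappedLE I k) 2 (.init a) :=
  branching_two_of_le hk (.init_fork a)

theorem Capped.branching_two_desc (hk : 2 ≤ k) (n : ℕ) : Branching (cappedLE I k) 2 (.desc n) :=
  branching_two_of_le hk (.desc_fork n)

/-- The root of a triple has an incomparable partner, the root of another triple, so its image must
lie in a triple; having two incomparable points above it, this image is again a root. Counting roots
gives the bound. -/
theorem Capped.card_le_of_embedding (e : cappedLE I k ↪r cappedLE J l) (hk : 2 ≤ k) : k ≤ l := by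
  have hfork : ∀ x : Fin k, ∃ y : Fin l, e (.fork x 0) = .fork y 0 := by
    intro x
    have hb := (branching_one_fork (I := I) x).map e
    obtain ⟨x', hx'⟩ : ∃ x' : Fin k, x ≠ x' := by
      have : Nontrivial (Fin k) := Fin.nontrivial_iff_two_le.2 hk
      exact (exists_ne x).imp fun _ => Ne.symm
    have h1 := mt e.map_rel_iff.1 (not_fork_le (I := I) hx' 0 0)
    have h2 := mt e.map_rel_iff.1 (not_fork_le (I := I) hx'.symm 0 0)
    cases h : e (.fork x 0) with
    | init a => exact absurd ((e (.fork x' 0)).le_or_le_init a) (by rw [← h]; tauto)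
    | desc n => exact absurd ((e (.fork x' 0)).le_or_le_desc n) (by rw [← h]; tauto)
    | fork y j =>
      rw [h] at hb
      exact ⟨y, by rw [eq_zero_of_branching_one hb]⟩
  choose g hg using hfork
  have hinj : Function.Injective g := by
    intro x y hxy
    have : e (.fork x 0) = e (.fork y 0) := by rw [hg, hg, hxy]
    simpa using e.injective this
  simpa using Fintype.card_le_of_injective g hinj

/-- Branching of height 2 keeps initial points out of the triples. If one went to `m*` in `ω*`, the
whole infinite `ω*` above it would have to go into the finitely many points of `ω*` above `m*`. -/
theorem Capped.exists_init_embedding (e : cappedLE I k ↪r cappedLE J l) (hk : 2 ≤ k) :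
    Nonempty (I ↪o J) := by
  have hinit : ∀ a : I, ∃ b : J, e (.init a) = .init b := by
    intro a
    cases h : e (.init a) with
    | init b => exact ⟨b, rfl⟩
    | fork x j =>
      have := (branching_two_init hk a).map e
      exact absurd (h ▸ this) (not_branching_two_fork x j)
    | desc m =>
      have hdesc : ∀ n, ∃ p, e (.desc n) = .desc p ∧ p ≤ m := by
        intro n
        have hle := e.map_rel_iff.2 (Le.init_desc a n)
        have hb := (branching_two_desc (I := I) hk n).map e
        rw [h] at hle
        cases h' : e (.desc n) with
        | init b => rw [h'] at hle; cases hle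
        | fork x j => rw [h'] at hb; exact absurd hb (not_branching_two_fork x j)
        | desc p => rw [h'] at hle; exact ⟨p, rfl, le_desc_iff.1 hle⟩
      choose p hp hpm using hdesc
      have hinj : Function.Injective p := by
        intro n n' hn
        have : e (.desc n) = e (.desc n') := by rw [hp, hp, hn]
        simpa using e.injective this
      exact absurd ((Set.finite_Iic m).subset (Set.range_subset_iff.2 hpm))
        (Set.infinite_range_of_injective hinj)
  choose g hg using hinit
  refine ⟨OrderEmbedding.ofMapLEIff g fun a b => ?_⟩
  rw [← le_init_iff (k := l), ← hg, ← hg]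
  exact e.map_rel_iff.trans le_init_iff

end Capped

/-! ### Branching in `G_T` -/

section Tree

variable {κ : Cardinal.{u}} {L : Below κ → Below κ → Below κ → Prop}
  {Lstar : SuccSeq κ (Fin 2) → Type u} [∀ w, LinearOrder (Lstar w)]
  {sharp : SuccSeq κ (Below κ) → Below κ} {T T' : Set (Node κ)}

theorem GLe.seq_seq_iff {s t : SuccSeq κ (Below κ)} :
    GLe L Lstar sharp T (.seq s) (.seq t) ↔ s.1 ≤ t.1 :=
  ⟨fun h => by cases h; assumption, .seq_seq s t⟩

theorem GLe.seq_stem_iff {s t : SuccSeq κ (Below κ)} {z : ℤ} :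
    GLe L Lstar sharp T (.seq s) (.stem t z) ↔ s.1 ≤ t.1 :=
  ⟨fun h => by cases h; assumption, .seq_stem s t z⟩

theorem GLe.stem_stem_iff {s : SuccSeq κ (Below κ)} {z z' : ℤ} :
    GLe L Lstar sharp T (.stem s z) (.stem s z') ↔ z ≤ z' :=
  ⟨fun h => by cases h; assumption, .stem_stem s z z'⟩

/-- The copy of the label of type I attached to `s`. -/
def labelIEmbedding (L : Below κ → Below κ → Below κ → Prop) (Lstar : SuccSeq κ (Fin 2) → Type u)
    [∀ w, LinearOrder (Lstar w)] (sharp : SuccSeq κ (Below κ) → Below κ) (T : Set (Node κ))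
    (s : SuccSeq κ (Below κ)) :
    LabelI.Le (γ := s.predLength) (L s.predLength) ↪r GLe L Lstar sharp T where
  toFun := .labelI s
  inj' _ _ h := by simpa using h
  map_rel_iff' := ⟨fun h => by cases h; assumption, .labelI_labelI s _ _⟩

/-- The copy of the label of type II attached to `s`. -/
def labelIIEmbedding (L : Below κ → Below κ → Below κ → Prop) (Lstar : SuccSeq κ (Fin 2) → Type u)
    [∀ w, LinearOrder (Lstar w)] (sharp : SuccSeq κ (Below κ) → Below κ) (T : Set (Node κ))
    (s : SuccSeq κ (Below κ)) :
    cappedLE (Set.Iio (theta 1 s.predLength (sharp s))) 3 ↪r GLe L Lstar sharp T where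
  toFun := .labelII s
  inj' _ _ h := by simpa using h
  map_rel_iff' := ⟨fun h => by cases h; assumption, .labelII_labelII s _ _⟩

/-- The copy of the label of type III given by `w` attached to `s`. -/
def labelIIIEmbedding (L : Below κ → Below κ → Below κ → Prop) (Lstar : SuccSeq κ (Fin 2) → Type u)
    [∀ w, LinearOrder (Lstar w)] (sharp : SuccSeq κ (Below κ) → Below κ) (T : Set (Node κ))
    (s : SuccSeq κ (Below κ)) (w : SuccSeq κ (Fin 2)) (h : (w.1, s.1) ∈ T) :
    cappedLE (Lstar w) 2 ↪r GLe L Lstar sharp T where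
  toFun := .labelIII s w h
  inj' _ _ h := by simpa using h
  map_rel_iff' := ⟨fun h => by cases h; assumption, .labelIII_labelIII s w h _ _⟩

theorem GLe.exists_labelI {s : SuccSeq κ (Below κ)} {x : LabelI κ s.predLength}
    {y : GDom Lstar sharp T} (h : GLe L Lstar sharp T (.labelI s x) y) :
    ∃ x', y = .labelI s x' := by
  cases h
  exact ⟨_, rfl⟩

theorem GLe.exists_labelII {s : SuccSeq κ (Below κ)} {x : LabelII sharp s}
    {y : GDom Lstar sharp T} (h : GLe L Lstar sharp T (.labelII s x) y) :
    ∃ x', y = .labelII s x' := by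
  cases h
  exact ⟨_, rfl⟩

theorem GLe.exists_labelIII {s : SuccSeq κ (Below κ)} {w : SuccSeq κ (Fin 2)}
    {hw : (w.1, s.1) ∈ T} {x : LabelIII Lstar w} {y : GDom Lstar sharp T}
    (h : GLe L Lstar sharp T (.labelIII s w hw x) y) : ∃ x', y = .labelIII s w hw x' := by
  cases h
  exact ⟨_, rfl⟩

theorem branching_labelI_iff {s : SuccSeq κ (Below κ)} {x : LabelI κ s.predLength} {n : ℕ} :
    Branching (GLe L Lstar sharp T) n (.labelI s x) ↔
      Branching (LabelI.Le (L s.predLength)) n x :=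
  ⟨Branching.of_map (labelIEmbedding L Lstar sharp T s) fun _ _ h => h.exists_labelI,
    Branching.map (labelIEmbedding L Lstar sharp T s)⟩

theorem branching_labelII_iff {s : SuccSeq κ (Below κ)} {x : LabelII sharp s} {n : ℕ} :
    Branching (GLe L Lstar sharp T) n (.labelII s x) ↔
      Branching (cappedLE (Set.Iio (theta 1 s.predLength (sharp s))) 3) n x :=
  ⟨Branching.of_map (labelIIEmbedding L Lstar sharp T s) fun _ _ h => h.exists_labelII,
    Branching.map (labelIIEmbedding L Lstar sharp T s)⟩

theorem branching_labelIII_iff {s : SuccSeq κ (Below κ)} {w : SuccSeq κ (Fin 2)}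
    {hw : (w.1, s.1) ∈ T} {x : LabelIII Lstar w} {n : ℕ} :
    Branching (GLe L Lstar sharp T) n (.labelIII s w hw x) ↔
      Branching (cappedLE (Lstar w) 2) n x :=
  ⟨Branching.of_map (labelIIIEmbedding L Lstar sharp T s w hw) fun _ _ h => h.exists_labelIII,
    Branching.map (labelIIIEmbedding L Lstar sharp T s w hw)⟩

/-- `y` belongs to one of the labels attached to `s`. -/
inductive IsLabelOf (s : SuccSeq κ (Below κ)) : GDom Lstar sharp T → Prop
  | labelI (x) : IsLabelOf s (.labelI s x)
  | labelII (x) : IsLabelOf s (.labelII s x)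
  | labelIII (w h x) : IsLabelOf s (.labelIII s w h x)

theorem IsLabelOf.stem_le {s : SuccSeq κ (Below κ)} {y : GDom Lstar sharp T} (h : IsLabelOf s y)
    (z : ℤ) : GLe L Lstar sharp T (.stem s z) y := by
  cases h
  · exact .stem_labelI _ _ _
  · exact .stem_labelII _ _ _
  · exact .stem_labelIII _ _ _ _ _

theorem GLe.of_stem {s : SuccSeq κ (Below κ)} {z : ℤ} {y : GDom Lstar sharp T}
    (h : GLe L Lstar sharp T (.stem s z) y) : (∃ z', y = .stem s z') ∨ IsLabelOf s y := by
  cases h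
  · exact Or.inl ⟨_, rfl⟩
  · exact Or.inr (.labelI _)
  · exact Or.inr (.labelII _)
  · exact Or.inr (.labelIII _ _ _)

theorem zero_lt_ord (hκ : ℵ₀ ≤ κ) : 0 < κ.ord :=
  Ordinal.omega0_pos.trans_le (Cardinal.omega0_le_ord.2 hκ)

theorem branching_seq (hκ : ℵ₀ ≤ κ) (n : ℕ) (s : SuccSeq κ (Below κ)) :
    Branching (GLe L Lstar sharp T) n (.seq s) := by
  induction n generalizing s with
  | zero => trivial
  | succ n ih =>
    let a : Below κ := ⟨0, zero_lt_ord hκ⟩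
    let b : Below κ := ⟨1, Ordinal.one_lt_omega0.trans_le (Cardinal.omega0_le_ord.2 hκ)⟩
    have hab : a ≠ b := fun h => zero_ne_one (congrArg Subtype.val h)
    refine ⟨.seq ⟨s.1.snoc hκ a, _, rfl⟩, .seq ⟨s.1.snoc hκ b, _, rfl⟩,
      .seq_seq _ _ (s.1.le_snoc hκ a), .seq_seq _ _ (s.1.le_snoc hκ b), ?_, ?_, ih _, ih _⟩
    · exact fun h => hab ((s.1.snoc_le_iff hκ a b).1 (GLe.seq_seq_iff.1 h))
    · exact fun h => hab.symm ((s.1.snoc_le_iff hκ b a).1 (GLe.seq_seq_iff.1 h))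

variable [∀ γ, IsLinearOrder (Below κ) (L γ)]

theorem IsLabelOf.not_branching_three {s : SuccSeq κ (Below κ)} {y : GDom Lstar sharp T}
    (h : IsLabelOf s y) : ¬ Branching (GLe L Lstar sharp T) 3 y := by
  cases h with
  | labelI x =>
    rw [branching_labelI_iff]
    exact fun h => x.not_branching_two h.of_succ
  | labelII x =>
    rw [branching_labelII_iff]
    exact x.not_branching_three
  | labelIII w h x =>
    rw [branching_labelIII_iff]
    exact x.not_branching_three

/-- Above a stem point, a point of height 3 must again be on the stem, and the stem is a chain. -/
theorem not_branching_four_stem (s : SuccSeq κ (Below κ)) (z : ℤ) :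
    ¬ Branching (GLe L Lstar sharp T) 4 (.stem s z) := by
  rintro ⟨x, y, hx, hy, hxy, hyx, hx3, hy3⟩
  obtain ⟨a, rfl⟩ := hx.of_stem.resolve_right fun h => h.not_branching_three hx3
  obtain ⟨b, rfl⟩ := hy.of_stem.resolve_right fun h => h.not_branching_three hy3
  rw [GLe.stem_stem_iff] at hxy hyx
  omega

theorem exists_eq_seq_of_branching_four {y : GDom Lstar sharp T}
    (h : Branching (GLe L Lstar sharp T) 4 y) : ∃ t, y = .seq t := by
  cases y with
  | seq t => exact ⟨t, rfl⟩
  | stem t z => exact absurd h (not_branching_four_stem t z)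
  | labelI t x => exact absurd h.of_succ (IsLabelOf.labelI x).not_branching_three
  | labelII t x => exact absurd h.of_succ (IsLabelOf.labelII x).not_branching_three
  | labelIII t w hw x => exact absurd h.of_succ (IsLabelOf.labelIII w hw x).not_branching_three

/-- Labels of types I and II are attached to every `s`, mutually incomparable, and each has points
of height 1. -/
theorem branching_two_stem (hκ : ℵ₀ ≤ κ) (hL_noMax : ∀ γ a, ∃ b, L γ a b ∧ b ≠ a)
    (s : SuccSeq κ (Below κ)) (z : ℤ) : Branching (GLe L Lstar sharp T) 2 (.stem s z) := by
  refine ⟨.labelI s (.base ⟨0, zero_lt_ord hκ⟩), .labelII s (.desc 0), .stem_labelI _ _ _,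
    .stem_labelII _ _ _, by rintro ⟨⟩, by rintro ⟨⟩, ?_, ?_⟩
  · exact branching_labelI_iff.2 (LabelI.branching_one_base (hL_noMax _) _)
  · exact branching_labelII_iff.2 (Capped.branching_two_desc (by norm_num) 0).of_succ

end Tree

/-! ### Embeddings of `G_T` into `G_T'` -/

section Embedding

variable {κ : Cardinal.{u}} {L : Below κ → Below κ → Below κ → Prop}
  {Lstar : SuccSeq κ (Fin 2) → Type u} {sharp : SuccSeq κ (Below κ) → Below κ} {T T' : Set (Node κ)}

/-- The size gap that separates labels: type I has `κ` base points, types II and III have fewer than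
`κ` points. -/
theorem isEmpty_below_embedding_labelII (hκ : κ.IsInaccessible) (t : SuccSeq κ (Below κ)) :
    IsEmpty (Below κ ↪ LabelII sharp t) := by
  refine ⟨fun f => (mk_le_of_injective f.injective).not_gt ?_⟩
  rw [mk_below]
  refine mk_capped_lt (by simpa using hκ.aleph0_lt) ?_
  rw [Cardinal.mk_Iio_ordinal, Cardinal.lift_lt, ← Cardinal.lt_ord]
  exact theta_lt hκ 1 t.predLength.2 (sharp t).2

theorem isEmpty_below_embedding_labelIII (hκ : κ.IsInaccessible)
    (hLstar_card : ∀ w, #(Lstar w) = mu w.predLength) (w : SuccSeq κ (Fin 2)) :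
    IsEmpty (Below κ ↪ LabelIII Lstar w) := by
  refine ⟨fun f => (lift_mk_le_lift_mk_of_injective f.injective).not_gt ?_⟩
  rw [mk_below, Cardinal.lift_lift]
  refine Cardinal.lift_lt.2 (mk_capped_lt hκ.aleph0_lt ?_)
  rw [hLstar_card]
  exact mu_lt hκ w.predLength.2

variable [∀ w, LinearOrder (Lstar w)]

theorem GLe.eq_of_stem_stem {s t : SuccSeq κ (Below κ)} {z z' : ℤ}
    (h : GLe L Lstar sharp T (.stem s z) (.stem t z')) : s = t := by
  cases h
  rfl

/-- Different labels at the same sequence are incomparable, so points comparable with a fixed one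
all lie in its label. The same holds for the other two types. -/
theorem GLe.exists_labelI_of_or {s : SuccSeq κ (Below κ)} {x : LabelI κ s.predLength}
    {y : GDom Lstar sharp T} (hy : IsLabelOf s y)
    (h : GLe L Lstar sharp T y (.labelI s x) ∨ GLe L Lstar sharp T (.labelI s x) y) :
    ∃ x', y = .labelI s x' := by
  cases hy with
  | labelI x' => exact ⟨_, rfl⟩
  | labelII x' => rcases h with h | h <;> cases h
  | labelIII w hw x' => rcases h with h | h <;> cases h

theorem GLe.exists_labelII_of_or {s : SuccSeq κ (Below κ)} {x : LabelII sharp s}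
    {y : GDom Lstar sharp T} (hy : IsLabelOf s y)
    (h : GLe L Lstar sharp T y (.labelII s x) ∨ GLe L Lstar sharp T (.labelII s x) y) :
    ∃ x', y = .labelII s x' := by
  cases hy with
  | labelI x' => rcases h with h | h <;> cases h
  | labelII x' => exact ⟨_, rfl⟩
  | labelIII w hw x' => rcases h with h | h <;> cases h

theorem GLe.exists_labelIII_of_or {s : SuccSeq κ (Below κ)} {w : SuccSeq κ (Fin 2)}
    {hw : (w.1, s.1) ∈ T} {x : LabelIII Lstar w} {y : GDom Lstar sharp T} (hy : IsLabelOf s y)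
    (h : GLe L Lstar sharp T y (.labelIII s w hw x) ∨
      GLe L Lstar sharp T (.labelIII s w hw x) y) :
    ∃ x', y = .labelIII s w hw x' := by
  cases hy with
  | labelI x' => rcases h with h | h <;> cases h
  | labelII x' => rcases h with h | h <;> cases h
  | labelIII w hw x' => rcases h with h | h <;> cases h <;> exact ⟨_, rfl⟩

variable [∀ γ, IsLinearOrder (Below κ) (L γ)]

theorem exists_seq_of_seq (hκ : ℵ₀ ≤ κ) (e : GLe L Lstar sharp T ↪r GLe L Lstar sharp T')
    (s : SuccSeq κ (Below κ)) : ∃ t, e (.seq s) = .seq t :=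
  exists_eq_seq_of_branching_four ((branching_seq hκ 4 s).map e)

theorem exists_stem_of_stem (hκ : κ.IsInaccessible) (hL_noMax : ∀ γ a, ∃ b, L γ a b ∧ b ≠ a)
    (hLstar_card : ∀ w, #(Lstar w) = mu w.predLength)
    (e : GLe L Lstar sharp T ↪r GLe L Lstar sharp T') (s : SuccSeq κ (Below κ)) (z : ℤ) :
    ∃ t z', e (.stem s z) = .stem t z' := by
  have habove : ∀ α : Below κ, GLe L Lstar sharp T' (e (.stem s z)) (e (.labelI s (.base α))) :=
    fun α => e.map_rel_iff.2 (.stem_labelI _ _ _)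
  have hinj : ∀ α β : Below κ, e (.labelI s (.base α)) = e (.labelI s (.base β)) → α = β := by
    intro α β h
    simpa using e.injective h
  cases h : e (.stem s z) with
  | stem t z' => exact ⟨t, z', rfl⟩
  -- Everything below a sequence is a sequence, so the descending half of the stem would give
  -- sequences of strictly decreasing ordinal length.
  | seq t =>
    exfalso
    have hseq : ∀ n : ℕ, ∃ t', e (.stem s (z - n)) = .seq t' := by
      intro n
      have hle : GLe L Lstar sharp T' (e (.stem s (z - n))) (e (.stem s z)) :=
        e.map_rel_iff.2 (.stem_stem _ _ _ (by omega))
      rw [h] at hle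
      cases h' : e (.stem s (z - n)) with
      | seq t' => exact ⟨t', rfl⟩
      | _ => rw [h'] at hle; cases hle
    choose t' ht' using hseq
    have hiff : ∀ n m : ℕ, (t' n).1 ≤ (t' m).1 ↔ m ≤ n := by
      intro n m
      rw [← GLe.seq_seq_iff (L := L) (Lstar := Lstar) (sharp := sharp) (T := T'), ← ht', ← ht',
        e.map_rel_iff, GLe.stem_stem_iff]
      omega
    refine not_strictAnti_of_wellFoundedLT (fun n => (t' n).1.length) fun n m hnm => ?_
    by_contra hc
    have heq := Seq.eq_of_le ((hiff m n).2 hnm.le) (not_lt.1 hc)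
    exact hnm.not_ge ((hiff n m).1 (heq ▸ Seq.le_refl _))
  | labelI t x =>
    have hb := (branching_two_stem hκ.aleph0_lt.le hL_noMax s z).map e
    rw [h, branching_labelI_iff] at hb
    exact absurd hb x.not_branching_two
  | labelII t x =>
    rw [h] at habove
    choose g hg using fun α => (habove α).exists_labelII
    exact ((isEmpty_below_embedding_labelII hκ t).false
      ⟨g, fun α β hαβ => hinj _ _ (by rw [hg, hg, hαβ])⟩).elim
  | labelIII t w hw x =>
    rw [h] at habove
    choose g hg using fun α => (habove α).exists_labelIII
    exact ((isEmpty_below_embedding_labelIII hκ hLstar_card w).false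
      ⟨g, fun α β hαβ => hinj _ _ (by rw [hg, hg, hαβ])⟩).elim

/-- A label point lies above the whole stem of `s`. Its image cannot be a stem point, since that
would bound a strictly increasing map from `ℤ` to `ℤ`. -/
theorem exists_isLabelOf (hκ : κ.IsInaccessible) (hL_noMax : ∀ γ a, ∃ b, L γ a b ∧ b ≠ a)
    (hLstar_card : ∀ w, #(Lstar w) = mu w.predLength)
    (e : GLe L Lstar sharp T ↪r GLe L Lstar sharp T') (s : SuccSeq κ (Below κ)) :
    ∃ t, (∃ z', e (.stem s 0) = .stem t z') ∧ ∀ y, IsLabelOf s y → IsLabelOf t (e y) := by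
  choose t g hg using exists_stem_of_stem hκ hL_noMax hLstar_card e s
  have ht : ∀ z, t z = t 0 := by
    intro z
    rcases le_total z 0 with h | h
    · have := e.map_rel_iff.2 (GLe.stem_stem (L := L) (Lstar := Lstar) (sharp := sharp) (T := T)
        s _ _ h)
      rw [hg, hg] at this
      exact this.eq_of_stem_stem
    · have := e.map_rel_iff.2 (GLe.stem_stem (L := L) (Lstar := Lstar) (sharp := sharp) (T := T)
        s _ _ h)
      rw [hg, hg] at this
      exact this.eq_of_stem_stem.symm
  have hg' : ∀ z, e (.stem s z) = .stem (t 0) (g z) := fun z => by rw [hg, ht]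
  refine ⟨t 0, ⟨g 0, hg 0⟩, fun y hy => ?_⟩
  have hle : ∀ z, GLe L Lstar sharp T' (.stem (t 0) (g z)) (e y) := fun z => by
    rw [← hg']
    exact e.map_rel_iff.2 (hy.stem_le z)
  refine (hle 0).of_stem.resolve_left ?_
  rintro ⟨z', hz'⟩
  have hmono : StrictMono g := by
    refine (OrderEmbedding.ofMapLEIff g fun a b => ?_).strictMono
    rw [← GLe.stem_stem_iff (L := L) (Lstar := Lstar) (sharp := sharp) (T := T') (s := t 0),
      ← hg', ← hg', e.map_rel_iff, GLe.stem_stem_iff]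
  have hbdd : ∀ z, g z ≤ z' := fun z => by
    have := hle z
    rwa [hz', GLe.stem_stem_iff] at this
  have hgrow : ∀ n : ℕ, g 0 + n ≤ g n := by
    intro n
    induction n with
    | zero => simp
    | succ n ih =>
      have : g n < g (n + 1 : ℕ) := hmono (by push_cast; omega)
      push_cast at this ⊢
      omega
  have h1 := hgrow (z' - g 0 + 1).toNat
  have h2 := hbdd ((z' - g 0 + 1).toNat : ℤ)
  omega

/-- An embedding maps the label of type I of `s` into that of the image of `s`. -/
theorem predLength_eq_of_isLabelOf (hκ : κ.IsInaccessible)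
    (hL_noMax : ∀ γ a, ∃ b, L γ a b ∧ b ≠ a) (hL : ∀ γ γ', γ ≠ γ' → IsEmpty (L γ ↪r L γ'))
    (hLstar_card : ∀ w, #(Lstar w) = mu w.predLength)
    (e : GLe L Lstar sharp T ↪r GLe L Lstar sharp T') {s t : SuccSeq κ (Below κ)}
    (hst : ∀ y, IsLabelOf s y → IsLabelOf t (e y)) : s.predLength = t.predLength := by
  have hcomp : ∀ α β : Below κ,
      GLe L Lstar sharp T' (e (.labelI s (.base α))) (e (.labelI s (.base β))) ∨
      GLe L Lstar sharp T' (e (.labelI s (.base β))) (e (.labelI s (.base α))) := fun α β => by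
    rw [e.map_rel_iff, e.map_rel_iff]
    exact (total_of (L s.predLength) α β).imp
      (fun h => .labelI_labelI _ _ _ (.base_base _ _ h))
      (fun h => .labelI_labelI _ _ _ (.base_base _ _ h))
  have hinj : ∀ α β : Below κ, e (.labelI s (.base α)) = e (.labelI s (.base β)) → α = β := by
    intro α β h
    simpa using e.injective h
  have hlab := fun α : Below κ => hst _ (.labelI (.base α))
  -- An arbitrary base point for reference: all others are comparable with it, so the label
  -- containing its image contains all their images.
  let a : Below κ := ⟨0, zero_lt_ord hκ.aleph0_lt.le⟩
  have ha := hlab a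
  have hcompa := fun α => hcomp α a
  generalize e (.labelI s (.base a)) = y at ha hcompa
  cases ha with
  | labelII x =>
    choose g hg using fun α => GLe.exists_labelII_of_or (hlab α) (hcompa α)
    exact ((isEmpty_below_embedding_labelII hκ t).false
      ⟨g, fun α β hαβ => hinj _ _ (by rw [hg, hg, hαβ])⟩).elim
  | labelIII w hw x =>
    choose g hg using fun α => GLe.exists_labelIII_of_or (hlab α) (hcompa α)
    exact ((isEmpty_below_embedding_labelIII hκ hLstar_card w).false
      ⟨g, fun α β hαβ => hinj _ _ (by rw [hg, hg, hαβ])⟩).elim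
  | labelI x =>
    -- Side points have no branching, so base points go to base points and the linear order `L_γ` is
    -- embedded.
    have hbase : ∀ α, ∃ β, e (.labelI s (.base α)) = .labelI t (.base β) := by
      intro α
      obtain ⟨x', hx'⟩ := GLe.exists_labelI_of_or (hlab α) (hcompa α)
      have hb : Branching (GLe L Lstar sharp T) 1 (.labelI s (.base α)) :=
        branching_labelI_iff.2 (LabelI.branching_one_base (hL_noMax _) α)
      have hb' := hb.map e
      rw [hx', branching_labelI_iff] at hb'
      obtain ⟨β, rfl⟩ := LabelI.exists_eq_base hb'
      exact ⟨β, hx'⟩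
    choose g hg using hbase
    by_contra hne
    refine (hL _ _ hne).false ⟨⟨g, fun α β hαβ => hinj _ _ (by rw [hg, hg, hαβ])⟩, ?_⟩
    intro α β
    have h := e.map_rel_iff (a := .labelI s (.base α)) (b := .labelI s (.base β))
    rw [hg, hg] at h
    have h1 := ((labelIEmbedding L Lstar sharp T' t).map_rel_iff (a := .base (g α))
      (b := .base (g β))).trans LabelI.le_base_base_iff
    have h2 := ((labelIEmbedding L Lstar sharp T s).map_rel_iff (a := .base α)
      (b := .base β)).trans LabelI.le_base_base_iff
    exact h1.symm.trans (h.trans h2)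

/-- A map of one label into another, induced by an embedding of trees. -/
theorem exists_capped_embedding {A B I J : Type*} [LinearOrder I] [LinearOrder J] {k l : ℕ}
    {r : A → A → Prop} {r' : B → B → Prop} (e : r ↪r r') (c : cappedLE I k ↪r r)
    (d : cappedLE J l ↪r r') (h : ∀ x, ∃ y, e (c x) = d y) :
    Nonempty (cappedLE I k ↪r cappedLE J l) := by
  choose g hg using h
  refine ⟨⟨⟨g, fun x y hxy => c.injective (e.injective (by rw [hg, hg, hxy]))⟩, fun {x y} => ?_⟩⟩
  have h1 := e.map_rel_iff (a := c x) (b := c y)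
  rw [hg, hg, d.map_rel_iff, c.map_rel_iff] at h1
  exact h1

/-- A label of type II or III is mapped into a single label of type II or III. -/
theorem exists_capped_embedding_of_isLabelOf {I : Type*} [LinearOrder I] {k : ℕ} (hk : 2 ≤ k)
    (e : GLe L Lstar sharp T ↪r GLe L Lstar sharp T') {s t : SuccSeq κ (Below κ)}
    (hst : ∀ y, IsLabelOf s y → IsLabelOf t (e y)) (c : cappedLE I k ↪r GLe L Lstar sharp T)
    (hc : ∀ x, IsLabelOf s (c x)) :
    Nonempty (cappedLE I k ↪r cappedLE (Set.Iio (theta 1 t.predLength (sharp t))) 3) ∨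
      ∃ w : SuccSeq κ (Fin 2), (w.1, t.1) ∈ T' ∧
        Nonempty (cappedLE I k ↪r cappedLE (Lstar w) 2) := by
  have hlab := fun x => hst _ (hc x)
  -- The top of `ω*` is comparable with every point of its label, which therefore cannot be split
  -- among several labels; its height 2 rules out type I.
  have hcomp : ∀ x, GLe L Lstar sharp T' (e (c x)) (e (c (.desc 0))) ∨
      GLe L Lstar sharp T' (e (c (.desc 0))) (e (c x)) := fun x => by
    rw [e.map_rel_iff, e.map_rel_iff, c.map_rel_iff, c.map_rel_iff]
    exact x.le_or_le_desc 0
  have h0 := hlab (.desc 0)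
  have hb := ((Capped.branching_two_desc (I := I) hk 0).map c).map e
  generalize e (c (.desc 0)) = y at h0 hcomp hb
  cases h0 with
  | labelI x =>
    rw [branching_labelI_iff] at hb
    exact absurd hb x.not_branching_two
  | labelII x =>
    exact Or.inl (exists_capped_embedding e c (labelIIEmbedding L Lstar sharp T' t) fun x =>
      GLe.exists_labelII_of_or (hlab x) (hcomp x))
  | labelIII w hw x =>
    exact Or.inr ⟨w, hw, exists_capped_embedding e c (labelIIIEmbedding L Lstar sharp T' t w hw)
      fun x => GLe.exists_labelIII_of_or (hlab x) (hcomp x)⟩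

/-- Three triples do not fit into two, so the target is the label of type II at `t`; its initial
parts are ordinals, and `θ(1, γ, ·)` is strictly increasing. -/
theorem sharp_le_of_isLabelOf (e : GLe L Lstar sharp T ↪r GLe L Lstar sharp T')
    {s t : SuccSeq κ (Below κ)} (hst : ∀ y, IsLabelOf s y → IsLabelOf t (e y))
    (hpred : s.predLength = t.predLength) : sharp s ≤ sharp t := by
  rcases exists_capped_embedding_of_isLabelOf (by norm_num) e hst
    (labelIIEmbedding L Lstar sharp T s) (fun x => .labelII x) with ⟨⟨f⟩⟩ | ⟨w, -, ⟨f⟩⟩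
  · obtain ⟨g⟩ := Capped.exists_init_embedding f (by norm_num)
    rw [← hpred] at g
    have h := (Ordinal.type_le_iff'.2 ⟨g.ltEmbedding⟩ :
      typeLT (Set.Iio (theta 1 s.predLength (sharp s))) ≤
        typeLT (Set.Iio (theta 1 s.predLength (sharp t))))
    rw [Ordinal.type_lt_Iio, Ordinal.type_lt_Iio, Ordinal.lift_le, theta_le_theta_iff] at h
    exact h
  · exact absurd (Capped.card_le_of_embedding f (by norm_num)) (by norm_num)

/-- A label of type II is excluded because its initial part is well-ordered. Otherwise `L*_w` embeds
into some `L*_w'` with `w'` of the same length, so `w' = w`. -/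
theorem mem_of_isLabelOf (hT : IsDSTTree T) (hT' : IsDSTTree T')
    (hLstar_notWF : ∀ w, ¬ WellFoundedLT (Lstar w))
    (hLstar : ∀ w w' : SuccSeq κ (Fin 2), w.predLength = w'.predLength → w ≠ w' →
      IsEmpty (Lstar w ↪o Lstar w'))
    (e : GLe L Lstar sharp T ↪r GLe L Lstar sharp T')
    {s t : SuccSeq κ (Below κ)} (hst : ∀ y, IsLabelOf s y → IsLabelOf t (e y))
    (hlen : s.1.length = t.1.length) {w : SuccSeq κ (Fin 2)} (hw : (w.1, s.1) ∈ T) :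
    (w.1, t.1) ∈ T' := by
  rcases exists_capped_embedding_of_isLabelOf le_rfl e hst
    (labelIIIEmbedding L Lstar sharp T s w hw) (fun x => .labelIII w hw x) with
    ⟨⟨f⟩⟩ | ⟨w', hw', ⟨f⟩⟩
  · obtain ⟨g⟩ := Capped.exists_init_embedding f le_rfl
    exact absurd g.strictMono.wellFoundedLT (hLstar_notWF w)
  · obtain ⟨g⟩ := Capped.exists_init_embedding f le_rfl
    have hww' : w = w' := by
      by_contra hne
      refine (hLstar w w' ?_ hne).false g
      rw [SuccSeq.predLength_eq_iff]
      exact (hT.length_eq _ hw).trans (hlen.trans (hT'.length_eq _ hw').symm)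
    rw [hww']
    exact hw'

/-- The image `f s` of a sequence and the sequence `t s` that receives its stem could a priori
differ. The sequence is below its stem, so `f s ≤ t s`; type I labels give `t s` the length of `s`,
and `f` cannot shorten sequences. -/
theorem exists_map_of_embedding (hκ : κ.IsInaccessible)
    (hL_noMax : ∀ γ a, ∃ b, L γ a b ∧ b ≠ a) (hL : ∀ γ γ', γ ≠ γ' → IsEmpty (L γ ↪r L γ'))
    (hLstar_card : ∀ w, #(Lstar w) = mu w.predLength)
    (hLstar_notWF : ∀ w, ¬ WellFoundedLT (Lstar w))
    (hLstar : ∀ w w' : SuccSeq κ (Fin 2), w.predLength = w'.predLength → w ≠ w' →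
      IsEmpty (Lstar w ↪o Lstar w'))
    (hT : IsDSTTree T) (hT' : IsDSTTree T')
    (e : GLe L Lstar sharp T ↪r GLe L Lstar sharp T') :
    ∃ f : SuccSeq κ (Below κ) → SuccSeq κ (Below κ), (∀ s, e (.seq s) = .seq (f s)) ∧
      (∀ s, (f s).1.length = s.1.length) ∧ (∀ s, sharp s ≤ sharp (f s)) ∧
      ∀ (w : SuccSeq κ (Fin 2)) (s : SuccSeq κ (Below κ)), (w.1, s.1) ∈ T → (w.1, (f s).1) ∈ T' := by
  choose f hf using exists_seq_of_seq hκ.aleph0_lt.le e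
  choose t ht hlab using exists_isLabelOf hκ hL_noMax hLstar_card e
  have hpred := fun s => predLength_eq_of_isLabelOf hκ hL_noMax hL hLstar_card e (hlab s)
  have hlen := fun s => (SuccSeq.predLength_eq_iff _ _).1 (hpred s)
  have hiff : ∀ s s', (f s).1 ≤ (f s').1 ↔ s.1 ≤ s'.1 := by
    intro s s'
    have := e.map_rel_iff (a := .seq s) (b := .seq s')
    rwa [hf, hf, GLe.seq_seq_iff, GLe.seq_seq_iff] at this
  have hft : ∀ s, (f s).1 ≤ (t s).1 := by
    intro s
    obtain ⟨z, hz⟩ := ht s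
    have := e.map_rel_iff.2 (GLe.seq_stem (L := L) (Lstar := Lstar) (sharp := sharp) (T := T)
      s s 0 (Seq.le_refl _))
    rwa [hf, hz, GLe.seq_stem_iff] at this
  -- If `f s` were shorter than `s`, the initial segment of `s` of length `(f s).length` would, by
  -- induction, have an image at least as long as `f s` and below it, hence equal to it, although
  -- `f` reflects the order.
  have hge : ∀ (α : Ordinal.{u}) (s : SuccSeq κ (Below κ)), s.1.length = α + 1 →
      α + 1 ≤ (f s).1.length := by
    intro α
    induction α using WellFoundedLT.induction with
    | ind α ih =>
      intro s hs
      rw [(f s).length_eq]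
      by_contra hc
      have hlt : ((f s).predLength : Ordinal.{u}) < α := by simpa using hc
      have hlt' : ((f s).predLength : Ordinal.{u}) < s.1.length :=
        hlt.trans (hs ▸ lt_add_one α)
      have h1 := ih _ hlt (s.1.takeSucc hlt') (s.1.length_takeSucc hlt')
      rw [← (f s).length_eq] at h1
      have h2 : (f (s.1.takeSucc hlt')).1 = (f s).1 :=
        Seq.eq_of_le ((hiff _ _).2 (s.1.takeSucc_le hlt')) h1
      have h3 := ((hiff s (s.1.takeSucc hlt')).1 (h2 ▸ Seq.le_refl _)).1
      rw [s.1.length_takeSucc, hs] at h3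
      exact h3.not_gt (by simpa using hlt)
  have heq : ∀ s, t s = f s := by
    intro s
    refine Subtype.ext (Seq.eq_of_le (hft s) ?_).symm
    rw [← hlen, s.length_eq]
    exact hge _ s s.length_eq
  refine ⟨f, hf, fun s => ?_, fun s => ?_, fun w s hw => ?_⟩
  · rw [← heq s]
    exact (hlen s).symm
  · rw [← heq]
    exact sharp_le_of_isLabelOf e (hlab s) (hpred s)
  · rw [← heq]
    exact mem_of_isLabelOf hT hT' hLstar_notWF hLstar e (hlab s) (hlen s) hw

end Embedding

/-! ### Embeddings of labels -/

section LabelMaps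

variable {κ : Cardinal.{u}}

/-- Labels of type I depend on the length only. -/
def LabelI.cast {γ γ' : Below κ} (h : γ = γ') (x : LabelI κ γ) : LabelI κ γ' := h ▸ x

theorem LabelI.cast_injective {γ γ' : Below κ} (h : γ = γ') :
    Function.Injective (LabelI.cast (κ := κ) h) := by
  subst h
  exact fun _ _ h => h

theorem LabelI.cast_le_cast_iff (L : Below κ → Below κ → Below κ → Prop) {γ γ' : Below κ}
    (h : γ = γ') {x y : LabelI κ γ} : Le (L γ') (x.cast h) (y.cast h) ↔ Le (L γ) x y := by
  subst h
  rfl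

variable {I J : Type*} {k : ℕ}

/-- The map of labels induced by a map of the initial parts. -/
def Capped.map (f : I → J) : Capped I k → Capped J k
  | .init a => .init (f a)
  | .desc n => .desc n
  | .fork x j => .fork x j

theorem Capped.map_injective {f : I → J} (hf : Function.Injective f) :
    Function.Injective (Capped.map (k := k) f) := by
  rintro (a | n | ⟨x, j⟩) (b | m | ⟨y, l⟩) h <;> simp_all [map, hf.eq_iff]

theorem Capped.map_le_map_iff [LinearOrder I] [LinearOrder J] {f : I → J}
    (hf : ∀ a b, f a ≤ f b ↔ a ≤ b) {x y : Capped I k} :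
    cappedLE J k (x.map f) (y.map f) ↔ cappedLE I k x y := by
  constructor
  · intro h
    cases x <;> cases y <;> cases h <;> constructor <;> first | assumption | simp_all
  · intro h
    cases h <;> constructor <;> first | assumption | simp_all

theorem Capped.map_inclusion_le_iff {A : Type*} [LinearOrder A] {s t : Set A} (h : s ⊆ t)
    {x y : Capped s k} :
    cappedLE t k (x.map (Set.inclusion h)) (y.map (Set.inclusion h)) ↔ cappedLE s k x y :=
  map_le_map_iff (f := Set.inclusion h) fun _ _ => Iff.rfl

end LabelMaps

/-! ### From witnesses to embeddings -/

section OfWitness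

variable {κ : Cardinal.{u}} {L : Below κ → Below κ → Below κ → Prop}
  {Lstar : SuccSeq κ (Fin 2) → Type u}
  {sharp : SuccSeq κ (Below κ) → Below κ} {T T' : Set (Node κ)}

/-- The sequence to which a point of `G_T` is attached. -/
def GDom.root : GDom Lstar sharp T → SuccSeq κ (Below κ)
  | .seq s => s
  | .stem s _ => s
  | .labelI s _ => s
  | .labelII s _ => s
  | .labelIII s _ _ _ => s

/-- The map of trees induced by a map `f` of sequences that preserves the length, does not decrease
`#` and preserves the labels of type III. -/
noncomputable def GDom.map (f : SuccSeq κ (Below κ) → SuccSeq κ (Below κ))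
    (hpred : ∀ s, s.predLength = (f s).predLength)
    (htheta : ∀ s, theta 1 s.predLength (sharp s) ≤ theta 1 (f s).predLength (sharp (f s)))
    (hmem : ∀ (w : SuccSeq κ (Fin 2)) (s : SuccSeq κ (Below κ)), (w.1, s.1) ∈ T →
      (w.1, (f s).1) ∈ T') :
    GDom Lstar sharp T → GDom Lstar sharp T'
  | .seq s => .seq (f s)
  | .stem s z => .stem (f s) z
  | .labelI s x => .labelI (f s) (x.cast (hpred s))
  | .labelII s x => .labelII (f s) (x.map (Set.inclusion (Set.Iio_subset_Iio (htheta s))))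
  | .labelIII s w h x => .labelIII (f s) w (hmem w s h) x

theorem GDom.root_map {f : SuccSeq κ (Below κ) → SuccSeq κ (Below κ)}
    {hpred : ∀ s, s.predLength = (f s).predLength}
    {htheta : ∀ s, theta 1 s.predLength (sharp s) ≤ theta 1 (f s).predLength (sharp (f s))}
    {hmem : ∀ (w : SuccSeq κ (Fin 2)) (s : SuccSeq κ (Below κ)), (w.1, s.1) ∈ T →
      (w.1, (f s).1) ∈ T'} (x : GDom Lstar sharp T) :
    (x.map f hpred htheta hmem).root = f x.root := by
  cases x <;> rfl

theorem GDom.map_injective {f : SuccSeq κ (Below κ) → SuccSeq κ (Below κ)}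
    (hf : Function.Injective f)
    {hpred : ∀ s, s.predLength = (f s).predLength}
    {htheta : ∀ s, theta 1 s.predLength (sharp s) ≤ theta 1 (f s).predLength (sharp (f s))}
    {hmem : ∀ (w : SuccSeq κ (Fin 2)) (s : SuccSeq κ (Below κ)), (w.1, s.1) ∈ T →
      (w.1, (f s).1) ∈ T'} :
    Function.Injective (GDom.map (Lstar := Lstar) f hpred htheta hmem) := by
  intro x y h
  have hroot : x.root = y.root := hf (by
    rw [← root_map (hpred := hpred) (htheta := htheta) (hmem := hmem), h, root_map])
  cases x <;> cases y <;> simp only [map, reduceCtorEq] at h <;>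
    (simp only [root] at hroot; subst hroot)
  · rfl
  · simpa using h
  · simpa [(LabelI.cast_injective _).eq_iff] using h
  · simpa [(Capped.map_injective (Set.inclusion_injective _)).eq_iff] using h
  · simpa using h

variable [∀ w, LinearOrder (Lstar w)]

theorem GLe.seq_le_iff {s : SuccSeq κ (Below κ)} {y : GDom Lstar sharp T} :
    GLe L Lstar sharp T (.seq s) y ↔ s.1 ≤ y.root.1 := by
  constructor
  · intro h
    cases h <;> assumption
  · intro h
    cases y <;> constructor <;> exact h

theorem GLe.labelII_iff {s : SuccSeq κ (Below κ)} {x y : LabelII sharp s} :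
    GLe L Lstar sharp T (.labelII s x) (.labelII s y) ↔
      cappedLE (Set.Iio (theta 1 s.predLength (sharp s))) 3 x y :=
  (labelIIEmbedding L Lstar sharp T s).map_rel_iff

theorem GLe.root_eq {x y : GDom Lstar sharp T} (h : GLe L Lstar sharp T x y) :
    (∃ s, x = .seq s) ∨ x.root = y.root := by
  cases h <;> first | exact Or.inr rfl | exact Or.inl ⟨_, rfl⟩

/-- For a sequence `x`, only the root of `y` matters. Otherwise comparable points have the same
root, and the comparison takes place within one stem or one label. -/
theorem GDom.map_le_map_iff {f : SuccSeq κ (Below κ) → SuccSeq κ (Below κ)}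
    (hf : Function.Injective f) (hle : ∀ s t, (f s).1 ≤ (f t).1 ↔ s.1 ≤ t.1)
    {hpred : ∀ s, s.predLength = (f s).predLength}
    {htheta : ∀ s, theta 1 s.predLength (sharp s) ≤ theta 1 (f s).predLength (sharp (f s))}
    {hmem : ∀ (w : SuccSeq κ (Fin 2)) (s : SuccSeq κ (Below κ)), (w.1, s.1) ∈ T →
      (w.1, (f s).1) ∈ T'} {x y : GDom Lstar sharp T} :
    GLe L Lstar sharp T' (x.map f hpred htheta hmem) (y.map f hpred htheta hmem) ↔
      GLe L Lstar sharp T x y := by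
  by_cases hx : ∃ s, x = .seq s
  · obtain ⟨s, rfl⟩ := hx
    rw [GLe.seq_le_iff, map, GLe.seq_le_iff, root_map, hle]
  by_cases hroot : x.root = y.root
  swap
  · refine iff_of_false (fun h => ?_) fun h => hroot (h.root_eq.resolve_left hx)
    rcases h.root_eq with ⟨s, hs⟩ | h'
    · refine hx ?_
      cases x <;> simp only [map, reduceCtorEq] at hs
      exact ⟨_, rfl⟩
    · rw [root_map, root_map] at h'
      exact hroot (hf h')
  cases x <;> cases y <;> (simp only [root] at hroot; subst hroot) <;>
    first
    | exact absurd ⟨_, rfl⟩ hx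
    | (refine iff_of_false ?_ ?_ <;> (intro h; cases h; done))
    | (refine iff_of_true ?_ ?_ <;> (constructor; done))
    | skip
  · exact GLe.stem_stem_iff.trans GLe.stem_stem_iff.symm
  · exact (labelIEmbedding L Lstar sharp T' _).map_rel_iff.trans
      ((LabelI.cast_le_cast_iff L _).trans
        (labelIEmbedding L Lstar sharp T _).map_rel_iff.symm)
  · exact GLe.labelII_iff.trans ((Capped.map_inclusion_le_iff _).trans GLe.labelII_iff.symm)
  -- The two points may belong to type III labels of different `w`; inverting the order relation
  -- forces the same `w`.
  · constructor
    · intro h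
      cases h
      constructor
      assumption
    · intro h
      cases h
      constructor
      assumption

/-- Trees with the same nodes of successor length give rise to the same partial order. -/
def GDom.ofMem (h : ∀ (w : SuccSeq κ (Fin 2)) (s : SuccSeq κ (Below κ)), (w.1, s.1) ∈ T →
    (w.1, s.1) ∈ T') : GDom Lstar sharp T → GDom Lstar sharp T'
  | .seq s => .seq s
  | .stem s z => .stem s z
  | .labelI s x => .labelI s x
  | .labelII s x => .labelII s x
  | .labelIII s w hw x => .labelIII s w (h w s hw) x

theorem GDom.ofMem_le {h : ∀ (w : SuccSeq κ (Fin 2)) (s : SuccSeq κ (Below κ)),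
    (w.1, s.1) ∈ T → (w.1, s.1) ∈ T'} {x y : GDom Lstar sharp T}
    (hxy : GLe L Lstar sharp T x y) : GLe L Lstar sharp T' (x.ofMem h) (y.ofMem h) := by
  cases hxy <;> constructor <;> assumption

theorem nonempty_relIso (h : ∀ (w : SuccSeq κ (Fin 2)) (s : SuccSeq κ (Below κ)),
    (w.1, s.1) ∈ T ↔ (w.1, s.1) ∈ T') :
    Nonempty (GLe L Lstar sharp T ≃r GLe L Lstar sharp T') := by
  have hl : Function.LeftInverse (GDom.ofMem (Lstar := Lstar) (sharp := sharp)
      fun w s => (h w s).2) (GDom.ofMem fun w s => (h w s).1) := by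
    intro x
    cases x <;> rfl
  have hr : Function.RightInverse (GDom.ofMem (Lstar := Lstar) (sharp := sharp)
      fun w s => (h w s).2) (GDom.ofMem fun w s => (h w s).1) := by
    intro x
    cases x <;> rfl
  refine ⟨⟨⟨_, _, hl, hr⟩, fun {x y} => ⟨fun hxy => ?_, GDom.ofMem_le⟩⟩⟩
  have := GDom.ofMem_le (h := fun w s => (h w s).2) hxy
  rwa [Equiv.coe_fn_mk, hl, hl] at this

/-- As lengths are preserved, `#s ≤ #φ(s)` says exactly that the ordinal in the type II label of `s`
is an initial segment of the one at `φ s`. -/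
theorem nonempty_relEmbedding_of_witness {φ : Seq κ (Below κ) → Seq κ (Below κ)}
    (h : IsMaxWitness (succPart T) T' φ)
    (hsharp : ∀ s, sharp s ≤ sharp (h.lipschitz.onSucc s)) :
    Nonempty (GLe L Lstar sharp T ↪r GLe L Lstar sharp T') := by
  have hpred : ∀ s, s.predLength = (h.lipschitz.onSucc s).predLength := fun s => by
    rw [SuccSeq.predLength_eq_iff]
    exact (h.lipschitz.length_eq s.1).symm
  have htheta : ∀ s, theta 1 s.predLength (sharp s) ≤
      theta 1 (h.lipschitz.onSucc s).predLength (sharp (h.lipschitz.onSucc s)) := fun s => by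
    rw [← hpred, theta_le_theta_iff]
    exact hsharp s
  have hinj : Function.Injective h.lipschitz.onSucc := fun s t hst =>
    Subtype.ext (h.injective (congrArg Subtype.val hst))
  exact ⟨⟨⟨GDom.map h.lipschitz.onSucc hpred htheta fun w s hw => h.map_mem _ _ ⟨hw, s.2⟩,
    GDom.map_injective hinj⟩, GDom.map_le_map_iff (htheta := htheta) hinj
    fun s t => h.lipschitz.le_iff h.injective _ _⟩⟩

end OfWitness

end LabelTree

/-! ### The main theorem -/

open LabelTree in
theorem mainTheorem6 (κ : Cardinal.{u}) (hκ : κ.IsInaccessible)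
    -- the map `#`, a bijection onto `κ` on the sequences of each successor length
    (sharp : LabelTree.SuccSeq κ (LabelTree.Below κ) → LabelTree.Below κ)
    (hsharp : ∀ γ : LabelTree.Below κ,
      Set.BijOn sharp {s | s.predLength = γ} Set.univ)
    -- the linear orders `L_γ` on `κ`
    (L : LabelTree.Below κ → LabelTree.Below κ → LabelTree.Below κ → Prop)
    (hL_linear : ∀ γ, IsLinearOrder (LabelTree.Below κ) (L γ))
    (hL_noMax : ∀ γ a, ∃ b, L γ a b ∧ b ≠ a)
    (hL : ∀ γ γ', γ ≠ γ' → IsEmpty (L γ ↪r L γ'))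
    -- the linear orders `L*_w`
    (Lstar : LabelTree.SuccSeq κ (Fin 2) → Type u) [∀ w, LinearOrder (Lstar w)]
    (hLstar_card : ∀ w, Cardinal.mk (Lstar w) = LabelTree.mu w.predLength)
    (hLstar_notWF : ∀ w, ¬ WellFoundedLT (Lstar w))
    (hLstar : ∀ w w', w.predLength = w'.predLength → w ≠ w' → IsEmpty (Lstar w ↪o Lstar w'))
    -- the trees
    (T T' : Set (LabelTree.Node κ))
    (hT : LabelTree.IsDSTTree T) (hT' : LabelTree.IsDSTTree T')
    (hT_height : LabelTree.height T = κ.ord) (hT'_height : LabelTree.height T' = κ.ord) :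
    (Nonempty (LabelTree.GLe L Lstar sharp T ↪r LabelTree.GLe L Lstar sharp T') ↔
      ∃ (φ : LabelTree.Seq κ (LabelTree.Below κ) → LabelTree.Seq κ (LabelTree.Below κ))
        (h : LabelTree.IsMaxWitness (LabelTree.succPart T) T' φ),
        ∀ s, sharp s ≤ sharp (h.lipschitz.onSucc s)) ∧
    ((LabelTree.HasNoTerminalLimitNode T ∨ LabelTree.IsLimitClosed T') →
      (Nonempty (LabelTree.GLe L Lstar sharp T ↪r LabelTree.GLe L Lstar sharp T') ↔
        ∃ (φ : LabelTree.Seq κ (LabelTree.Below κ) → LabelTree.Seq κ (LabelTree.Below κ))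
          (h : LabelTree.IsMaxWitness T T' φ),
          ∀ s, sharp s ≤ sharp (h.lipschitz.onSucc s))) ∧
    (Nonempty (LabelTree.GLe L Lstar sharp T ≃r LabelTree.GLe L Lstar sharp T') ↔
      LabelTree.succPart T = LabelTree.succPart T') := by
  have := hL_linear
  have hκ0 := hκ.aleph0_lt.le
  have key1 : Nonempty (GLe L Lstar sharp T ↪r GLe L Lstar sharp T') ↔
      ∃ (φ : Seq κ (Below κ) → Seq κ (Below κ)) (h : IsMaxWitness (succPart T) T' φ),
        ∀ s, sharp s ≤ sharp (h.lipschitz.onSucc s) := by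
    constructor
    · rintro ⟨e⟩
      obtain ⟨f, hf, hlen, hsh, hmem⟩ := exists_map_of_embedding hκ hL_noMax hL hLstar_card
        hLstar_notWF hLstar hT hT' e
      have hiff : ∀ s s', (f s).1 ≤ (f s').1 ↔ s.1 ≤ s'.1 := by
        intro s s'
        have := e.map_rel_iff (a := .seq s) (b := .seq s')
        rwa [hf, hf, GLe.seq_seq_iff, GLe.seq_seq_iff] at this
      have hext := extendSucc_eq (hlen := hlen) fun s t => (hiff s t).2
      refine ⟨extendSucc f hlen, ⟨isLipschitz_extendSucc hlen,
        (isLipschitz_extendSucc hlen).injective fun s t hst => ?_, fun w s hws => ?_⟩, fun s => ?_⟩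
      · rw [hext, hext] at hst
        exact Subtype.ext (Seq.le_antisymm ((hiff _ _).1 (hst ▸ Seq.le_refl _))
          ((hiff _ _).1 (hst ▸ Seq.le_refl _)))
      · obtain ⟨hws, γ, hγ⟩ := hws
        have h := hmem ⟨w, γ, (hT.length_eq _ hws).trans hγ⟩ ⟨s, γ, hγ⟩ hws
        exact (congrArg (fun r => (w, r) ∈ T') (hext ⟨s, γ, hγ⟩)).mpr h
      · have hs : (isLipschitz_extendSucc hlen).onSucc s = f s := Subtype.ext (hext s)
        exact (hsh s).trans_eq (congrArg sharp hs.symm)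
    · rintro ⟨φ, h, hs⟩
      exact nonempty_relEmbedding_of_witness h hs
  refine ⟨key1, fun hlim => key1.trans ⟨?_, ?_⟩, ?_, ?_⟩
  · rintro ⟨φ, h, hs⟩
    exact ⟨φ, h.of_succPart hκ0 hT hT' hT_height hlim, hs⟩
  · rintro ⟨φ, h, hs⟩
    exact ⟨φ, h.succPart, hs⟩
  · rintro ⟨e⟩
    obtain ⟨f, hf, hlen, hsh, hmem⟩ := exists_map_of_embedding hκ hL_noMax hL hLstar_card
      hLstar_notWF hLstar hT hT' e.toRelEmbedding
    obtain ⟨f', hf', hlen', hsh', hmem'⟩ := exists_map_of_embedding hκ hL_noMax hL hLstar_card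
      hLstar_notWF hLstar hT' hT e.symm.toRelEmbedding
    have hinv : ∀ s, f' (f s) = s := by
      intro s
      have h1 := hf' (f s)
      rw [← hf s] at h1
      simpa using h1.symm
    -- Applying the `#` inequality to `f` and to its inverse gives `#s ≤ #f(s) ≤ #s`, and `#` is
    -- injective on sequences of a given length.
    have hid : ∀ s, f s = s := by
      intro s
      refine (hsharp s.predLength).injOn ?_ rfl (le_antisymm ?_ (hsh s))
      · exact (SuccSeq.predLength_eq_iff _ _).2 (hlen s)
      · simpa only [hinv] using hsh' (f s)
    have hid' : ∀ s, f' s = s := fun s => by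
      conv_lhs => rw [← hid s]
      exact hinv s
    ext ⟨w, s⟩
    constructor
    · rintro ⟨hws, γ, hγ⟩
      have h := hmem ⟨w, γ, (hT.length_eq _ hws).trans hγ⟩ ⟨s, γ, hγ⟩ hws
      have hs := congrArg Subtype.val (hid ⟨s, γ, hγ⟩)
      exact ⟨(congrArg (fun r => (w, r) ∈ T') hs).mp h, γ, hγ⟩
    · rintro ⟨hws, γ, hγ⟩
      have h := hmem' ⟨w, γ, (hT'.length_eq _ hws).trans hγ⟩ ⟨s, γ, hγ⟩ hws
      have hs := congrArg Subtype.val (hid' ⟨s, γ, hγ⟩)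
      exact ⟨(congrArg (fun r => (w, r) ∈ T) hs).mp h, γ, hγ⟩
  · intro h
    refine nonempty_relIso fun w s => ?_
    have h1 := Set.ext_iff.1 h (w.1, s.1)
    exact ⟨fun hw => (h1.1 ⟨hw, s.2⟩).1, fun hw => (h1.2 ⟨hw, s.2⟩).1⟩
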